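/- **Theorem 1.5 (Hypergraph removal lemma).** A *hypergraph system* is a quadruple $(J,(V_j)_{j\in J},d,H_d)$, where $J$ is a finite set, the $V_j$ are finite non-empty sets, $d\ge 1$ is an integer, and $H_d$ is a collection of $d$-element subsets of $J$. Write $V_J=\prod_{j\in J}V_j$. For $f:V_J\to\mathbf R$ let $\mathbf E(f)=\frac1{|V_J|}\sum_{x\in V_J}f(x)$. For $e\subseteq J$ let $\pi_e:V_J\to\prod_{j\in e}V_j$ be the canonical projection and let $\mathcal A_e=\{\pi_e^{-1}(E):E\subseteq\prod_{j\in e}V_j\}$, a $\sigma$-algebra on $V_J$. For a $\sigma$-algebra $\mathcal B$ on $V_J$ let $\mathrm{complex}(\mathcal B)$ be the least number of subsets of $V_J$ that generate $\mathcal B$ as a $\sigma$-algebra. For a family of $\sigma$-algebras, $\bigvee$ denotes the smallest $\sigma$-algebra containing all of them. For every finite set $J$ there are functions $c_J:(0,1)\to\mathbf R$ with $c_J(\delta)\to0$ as $\delta\to0$, and $C_J:(0,1)\to\mathbf N$, such that the following holds. Let $(J,(V_j)_{j\in J},d,H_d)$ be a hypergraph system on $J$, let $0<\delta<1$, and for each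 $e\in H_d$ let $E_e\in\mathcal A_e$, such that $$\mathbf E\Big(\prod_{e\in H_d}1_{E_e}\Big)\le\delta.$$ Then there are sets $E'_e\in\mathcal A_e$ for $e\in H_d$, and $\sigma$-algebras $\mathcal B_{e'}\subseteq\mathcal A_{e'}$ for all $e'\subseteq J$ with $|e'|<d$, such that $$\bigcap_{e\in H_d}E'_e=\emptyset,\qquad \mathbf E(1_{E_e\setminus E'_e})\le c_J(\delta)\quad\text{for all }e\in H_d,$$ $$\mathrm{complex}(\mathcal B_{e'})\le C_J(\delta)\quad\text{for all }e'\subseteq J\text{ with }|e'|<d,\qquad E'_e\in\bigvee_{e'\subsetneq e}\mathcal B_{e'}\quad\text{for all }e\in H_d.$$ (An empty product is $1$ and an empty intersection is $V_J$, so the hypothesis $\delta<1$ forces $H_d\neq\emptyset$.) -/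

import Mathlib

open Filter Topology MeasureTheory

universe u v

/-- A hypergraph system `(J, (V_j)_{j ∈ J}, d, H_d)` over the finite index set `J`: finite non-empty
sets `V j`, an integer `d ≥ 1`, and a `d`-uniform hypergraph `H` on `J`. -/
structure HypergraphSystem (J : Type u) where
  V : J → Type v
  fintypeV : ∀ j, Fintype (V j)
  nonemptyV : ∀ j, Nonempty (V j)
  d : ℕ
  one_le_d : 1 ≤ d
  H : Finset (Finset J)
  card_eq : ∀ e ∈ H, e.card = d

namespace HypergraphSystem

variable {J : Type u}

instance instFintypeV (S : HypergraphSystem.{u, v} J) (j : J) : Fintype (S.V j) := S.fintypeV j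

instance instNonemptyV (S : HypergraphSystem.{u, v} J) (j : J) : Nonempty (S.V j) := S.nonemptyV j

/-- The product `V_e = ∏_{j ∈ e} V_j`. -/
abbrev EdgeProd (S : HypergraphSystem.{u, v} J) (e : Finset J) : Type (max u v) := (j : e) → S.V j

/-- The full product `V_J = ∏_{j ∈ J} V_j`. -/
abbrev Total (S : HypergraphSystem.{u, v} J) : Type (max u v) := (j : J) → S.V j

/-- The canonical projection `π_e : V_J → V_e`. -/
def proj (S : HypergraphSystem.{u, v} J) (e : Finset J) (x : S.Total) : S.EdgeProd e := fun j => x j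

/-- The σ-algebra `𝒜_e = {π_e⁻¹(E) : E ⊆ V_e}` on `V_J`. -/
@[reducible] def sigmaAlg (S : HypergraphSystem.{u, v} J) (e : Finset J) : MeasurableSpace S.Total :=
  MeasurableSpace.comap (S.proj e) ⊤

/-- The expectation `𝐄(f) = |V_J|⁻¹ ∑_{x ∈ V_J} f(x)`. -/
noncomputable def expectation [Fintype J] [DecidableEq J] (S : HypergraphSystem.{u, v} J)
    (f : S.Total → ℝ) : ℝ :=
  (∑ x : S.Total, f x) / (Fintype.card S.Total : ℝ)

end HypergraphSystem

/-- The real-valued indicator function `1_E`. -/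
noncomputable def indicatorFn {X : Type*} (E : Set X) : X → ℝ := E.indicator (fun _ => (1 : ℝ))

/-- The complexity of a σ-algebra: the least number of sets needed to generate it
(with values in `ℕ∞`; it is finite when `X` is finite). -/
noncomputable def sigmaComplexity {X : Type*} (m : MeasurableSpace X) : ℕ∞ :=
  ⨅ (G : Set (Set X)) (_ : MeasurableSpace.generateFrom G = m), G.encard

open scoped ENNReal

/-! The proof is by compactness. If for some ε no pair (δ, N) worked, there would be counterexamples
with δ = 1/(n+2) and N = n. On the ultraproduct of their vertex products, limiting densities define
a countably additive Loeb measure, and the edge sets become internal sets with null intersection. A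
removal lemma for null intersections there, whose output uses finitely many internal sets and has
empty intersection, descends to some finite system with n above the number of sets used: a
contradiction.

The carrying fact is an orthogonality, `setIntegral_eq_zero_of_traces`. Freezing the coordinates
outside e turns a set depending on e' into one depending on e' ∩ e; so a function on e orthogonal to
the traces of a family of edges is orthogonal to the family itself. Hence the conditional
probability of a set on a j-edge, given the smaller edges inside it, is not changed by also
conditioning on the other j-edges. In a null intersection, each top-level set may therefore be
replaced by the locus where its conditional probability is positive
(`measure_iInter_condPos_inter_eq_zero`).

The infinitary removal lemma `exists_finGen_iInter_eq_empty` is an induction on edge size.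
`exists_atoms_measurable_of_null` first reduces the top-level dependence to finitely many atoms
while keeping the intersection null. On each tuple of atoms the sets are of lower order; with the
atoms replaced by their positivity loci, the induction hypothesis applies, and the finitely many
answers are recombined. -/

/-- The average of a real function on a finite type. -/
noncomputable def avg {X : Type*} [Fintype X] (f : X → ℝ) : ℝ := (∑ x, f x) / (Fintype.card X : ℝ)

/-! ### Averages over finite sets -/

section avg

variable {X : Type*} [Fintype X]

theorem avg_add (f g : X → ℝ) : avg (fun x => f x + g x) = avg f + avg g := by
  simp only [avg, Finset.sum_add_distrib, add_div]

theorem avg_const_mul (c : ℝ) (f : X → ℝ) : avg (fun x => c * f x) = c * avg f := by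
  simp only [avg, ← Finset.mul_sum, mul_div_assoc]

theorem avg_mono {f g : X → ℝ} (h : ∀ x, f x ≤ g x) : avg f ≤ avg g := by
  unfold avg
  gcongr
  exact h _

theorem avg_const [Nonempty X] (c : ℝ) : avg (fun _ : X => c) = c := by
  simp [avg]

theorem abs_avg_le (f : X → ℝ) : |avg f| ≤ avg fun x => |f x| := by
  unfold avg
  rw [abs_div, Nat.abs_cast]
  gcongr
  exact Finset.abs_sum_le_sum_abs _ _

end avg

/-! ### Ultraproducts, saturation and the Loeb measure -/

/-- Sequences of points, regarded as the underlying space of an ultraproduct. -/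
def Ultra (X : ℕ → Type*) := ∀ n, X n

namespace Ultra

variable {X : ℕ → Type*}

/-- The internal set determined by a sequence of sets. -/
def lift (A : Set (Σ n, X n)) : Set (Ultra X) := {x | ∀ᶠ n in hyperfilter ℕ, ⟨n, x n⟩ ∈ A}

theorem mem_lift {A : Set (Σ n, X n)} {x : Ultra X} :
    x ∈ lift A ↔ ∀ᶠ n in hyperfilter ℕ, (⟨n, x n⟩ : Σ n, X n) ∈ A := Iff.rfl

theorem lift_compl (A : Set (Σ n, X n)) : lift Aᶜ = (lift A)ᶜ := by
  ext x
  simp only [mem_lift, Set.mem_compl_iff, Ultrafilter.eventually_not]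

theorem lift_inter (A B : Set (Σ n, X n)) : lift (A ∩ B) = lift A ∩ lift B := by
  ext x
  simp only [mem_lift, Set.mem_inter_iff, eventually_and]

theorem lift_union (A B : Set (Σ n, X n)) : lift (A ∪ B) = lift A ∪ lift B := by
  ext x
  simp only [mem_lift, Set.mem_union, Ultrafilter.eventually_or]

theorem lift_diff (A B : Set (Σ n, X n)) : lift (A \ B) = lift A \ lift B := by
  rw [Set.sdiff_eq, lift_inter, lift_compl, Set.sdiff_eq]

@[simp] theorem lift_empty : lift (∅ : Set (Σ n, X n)) = ∅ := by
  ext x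
  simp [mem_lift, (hyperfilter ℕ).neBot.ne]

@[simp] theorem lift_univ : lift (Set.univ : Set (Σ n, X n)) = Set.univ := by
  ext x
  simp [mem_lift]

theorem mem_lift_forall {ι : Type*} [Finite ι] (A : ι → Set (Σ n, X n)) {x : Ultra X} :
    x ∈ lift (⋂ i, A i) ↔ ∀ i, x ∈ lift (A i) := by
  simp only [mem_lift, Set.mem_iInter, eventually_all]

theorem lift_iInter {ι : Type*} [Finite ι] (A : ι → Set (Σ n, X n)) :
    lift (⋂ i, A i) = ⋂ i, lift (A i) := by
  ext x
  simp [mem_lift_forall]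

/-- Picking a point of `A` outside `B` in every fibre that has one turns failure on a large set of
indices into a single point of `lift A` outside `lift B`. This is what makes the limiting density
depend on the internal set alone. -/
theorem eventually_of_lift_subset [∀ n, Nonempty (X n)] {A B : Set (Σ n, X n)}
    (h : lift A ⊆ lift B) :
    ∀ᶠ n in hyperfilter ℕ, ∀ x : X n, (⟨n, x⟩ : Σ n, X n) ∈ A → (⟨n, x⟩ : Σ n, X n) ∈ B := by
  classical
  have key : ∀ n, ∃ x : X n, (∃ y : X n, (⟨n, y⟩ : Σ n, X n) ∈ A ∧ (⟨n, y⟩ : Σ n, X n) ∉ B) →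
      ((⟨n, x⟩ : Σ n, X n) ∈ A ∧ (⟨n, x⟩ : Σ n, X n) ∉ B) := by
    intro n
    by_cases hy : ∃ y : X n, (⟨n, y⟩ : Σ n, X n) ∈ A ∧ (⟨n, y⟩ : Σ n, X n) ∉ B
    · exact ⟨hy.choose, fun _ => hy.choose_spec⟩
    · exact ⟨Classical.arbitrary _, fun h => absurd h hy⟩
  choose x hx using key
  by_contra hcon
  rw [← Ultrafilter.eventually_not] at hcon
  have hA : (x : Ultra X) ∈ lift A := by
    filter_upwards [hcon] with n hn
    push Not at hn
    exact (hx n hn).1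
  have hB : (x : Ultra X) ∈ lift Bᶜ := by
    filter_upwards [hcon] with n hn
    push Not at hn
    exact (hx n hn).2
  rw [lift_compl] at hB
  exact hB (h hA)

/-- Countable saturation: a decreasing sequence of non-empty internal sets has a common point. -/
theorem nonempty_iInter_lift [∀ n, Nonempty (X n)] (A : ℕ → Set (Σ n, X n))
    (hA : Antitone fun k => lift (A k)) (hne : ∀ k, (lift (A k)).Nonempty) :
    (⋂ k, lift (A k)).Nonempty := by
  classical
  -- In fibre `n` the point is chosen for the largest `k ≤ n` with `P n k`; it then serves every
  -- smaller index too.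
  let P : ℕ → ℕ → Prop := fun n k => ∃ x : X n, ∀ i ≤ k, (⟨n, x⟩ : Σ n, X n) ∈ A i
  have hP : ∀ k, ∀ᶠ n in hyperfilter ℕ, P n k := by
    intro k
    obtain ⟨x, hx⟩ := hne k
    have : ∀ i ∈ Finset.range (k + 1), ∀ᶠ n in hyperfilter ℕ, (⟨n, x n⟩ : Σ n, X n) ∈ A i :=
      fun i hi => hA (Nat.lt_succ_iff.mp (Finset.mem_range.mp hi)) hx
    filter_upwards [(Finset.eventually_all _).mpr this] with n hn
    exact ⟨x n, fun i hi => hn i (Finset.mem_range.mpr (by omega))⟩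
  have key : ∀ n, ∃ x : X n, ∀ k ≤ n, P n k → (⟨n, x⟩ : Σ n, X n) ∈ A k := by
    intro n
    by_cases h : P n (Nat.findGreatest (P n) n)
    · refine ⟨h.choose, fun k hk hPk => h.choose_spec k (Nat.le_findGreatest hk hPk)⟩
    · refine ⟨Classical.arbitrary _, fun k hk hPk => absurd (Nat.findGreatest_spec hk hPk) h⟩
  choose x hx using key
  refine ⟨x, Set.mem_iInter.mpr fun k => ?_⟩
  filter_upwards [hP k, Nat.hyperfilter_le_atTop (eventually_ge_atTop k)] with n h1 h2
  exact hx n k h2 h1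

instance instMeasurableSpace : MeasurableSpace (Ultra X) :=
  MeasurableSpace.generateFrom (Set.range lift)

theorem measurableSet_lift (A : Set (Σ n, X n)) : MeasurableSet (lift A) :=
  MeasurableSpace.measurableSet_generateFrom ⟨A, rfl⟩

theorem isSetRing_range_lift : IsSetRing (Set.range (lift : Set (Σ n, X n) → Set (Ultra X))) where
  empty_mem := ⟨∅, lift_empty⟩
  union_mem := by
    rintro _ _ ⟨A, rfl⟩ ⟨B, rfl⟩
    exact ⟨A ∪ B, lift_union A B⟩
  sdiff_mem := by
    rintro _ _ ⟨A, rfl⟩ ⟨B, rfl⟩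
    exact ⟨A \ B, lift_diff A B⟩

variable [∀ n, Fintype (X n)]

/-- The density of the `n`-th fibre of `A`. -/
noncomputable def freq (A : Set (Σ n, X n)) (n : ℕ) : ℝ :=
  avg fun x : X n => A.indicator (fun _ => (1 : ℝ)) ⟨n, x⟩

theorem freq_nonneg (A : Set (Σ n, X n)) (n : ℕ) : 0 ≤ freq A n :=
  div_nonneg (Finset.sum_nonneg fun _ _ => Set.indicator_nonneg (fun _ _ => zero_le_one) _)
    (Nat.cast_nonneg _)

/-- The limiting density of `A` along the ultrafilter. -/
noncomputable def ulim (A : Set (Σ n, X n)) : ℝ≥0∞ :=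
  ((hyperfilter ℕ).map fun n => ENNReal.ofReal (freq A n)).lim

theorem tendsto_ulim (A : Set (Σ n, X n)) :
    Tendsto (fun n => ENNReal.ofReal (freq A n)) (hyperfilter ℕ) (𝓝 (ulim A)) :=
  Ultrafilter.le_nhds_lim ((hyperfilter ℕ).map fun n => ENNReal.ofReal (freq A n))

theorem ulim_congr {A B : Set (Σ n, X n)} (h : ∀ᶠ n in hyperfilter ℕ, freq A n = freq B n) :
    ulim A = ulim B := by
  refine tendsto_nhds_unique (tendsto_ulim A) ((tendsto_ulim B).congr' ?_)
  filter_upwards [h] with n hn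
  rw [hn]

theorem ulim_union {A B : Set (Σ n, X n)}
    (h : ∀ᶠ n in hyperfilter ℕ, ∀ x : X n, (⟨n, x⟩ : Σ n, X n) ∈ A → (⟨n, x⟩ : Σ n, X n) ∉ B) :
    ulim (A ∪ B) = ulim A + ulim B := by
  refine tendsto_nhds_unique (tendsto_ulim _)
    (((tendsto_ulim A).add (tendsto_ulim B)).congr' ?_)
  filter_upwards [h] with n hn
  rw [← ENNReal.ofReal_add (freq_nonneg _ _) (freq_nonneg _ _), freq, freq, freq, ← avg_add]
  congr 2
  ext x
  by_cases hA : (⟨n, x⟩ : Σ n, X n) ∈ A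
  · simp [hA, hn x hA]
  · by_cases hB : (⟨n, x⟩ : Σ n, X n) ∈ B <;> simp [hA, hB]

theorem ulim_empty : ulim (∅ : Set (Σ n, X n)) = 0 := by
  refine tendsto_nhds_unique (tendsto_ulim _) ?_
  simp [freq, avg]

variable [∀ n, Nonempty (X n)]

theorem ulim_univ : ulim (Set.univ : Set (Σ n, X n)) = 1 := by
  refine tendsto_nhds_unique (tendsto_ulim _) ?_
  simp [freq, avg_const]

theorem ulim_eq_of_lift_eq {A B : Set (Σ n, X n)} (h : lift A = lift B) : ulim A = ulim B := by
  refine ulim_congr ?_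
  filter_upwards [eventually_of_lift_subset h.le, eventually_of_lift_subset h.ge] with n h1 h2
  unfold freq
  congr 1
  ext x
  have : (⟨n, x⟩ : Σ n, X n) ∈ A ↔ (⟨n, x⟩ : Σ n, X n) ∈ B := ⟨h1 x, h2 x⟩
  by_cases hA : (⟨n, x⟩ : Σ n, X n) ∈ A
  · simp [hA, this.mp hA]
  · simp [hA, mt this.mpr hA]

open Classical in
/-- The finitely additive Loeb content of an internal set. -/
noncomputable def loebFun (s : Set (Ultra X)) : ℝ≥0∞ :=
  if h : ∃ A, lift A = s then ulim h.choose else 0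

theorem loebFun_lift (A : Set (Σ n, X n)) : loebFun (lift A) = ulim A := by
  have h : ∃ B, lift B = lift A := ⟨A, rfl⟩
  rw [loebFun, dif_pos h]
  exact ulim_eq_of_lift_eq h.choose_spec

/-- The Loeb content on the ring of internal sets. -/
noncomputable def loebContent :
    AddContent ℝ≥0∞ (Set.range (lift : Set (Σ n, X n) → Set (Ultra X))) :=
  IsSetRing.addContent_of_union loebFun isSetRing_range_lift
    (by rw [← lift_empty, loebFun_lift, ulim_empty])
    (by
      rintro _ _ ⟨A, rfl⟩ ⟨B, rfl⟩ hAB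
      rw [← lift_union, loebFun_lift, loebFun_lift, loebFun_lift]
      refine ulim_union (eventually_of_lift_subset (A := A) (B := Bᶜ) ?_)
      rw [lift_compl]
      exact hAB.subset_compl_right)

theorem loebContent_lift (A : Set (Σ n, X n)) : loebContent (lift A) = ulim A :=
  loebFun_lift A

theorem ulim_le_one (A : Set (Σ n, X n)) : ulim A ≤ 1 := by
  have h := ulim_union (A := A) (B := Aᶜ) (Eventually.of_forall fun n x h1 h2 => h2 h1)
  rw [Set.union_compl_self, ulim_univ] at h
  rw [h]
  exact le_self_add

/-- By saturation, a decreasing sequence of internal sets with empty intersection is empty from some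
index on, so continuity at the empty set is automatic. -/
theorem isSigmaSubadditive_loebContent : (loebContent (X := X)).IsSigmaSubadditive := by
  refine isSigmaSubadditive_of_addContent_iUnion_eq_tsum isSetRing_range_lift
    (addContent_iUnion_eq_sum_of_tendsto_zero isSetRing_range_lift _ ?_ ?_)
  · rintro _ ⟨A, rfl⟩
    rw [loebContent_lift]
    exact ((ulim_le_one A).trans_lt ENNReal.one_lt_top).ne
  · intro s hs hanti hempty
    choose A hA using hs
    obtain rfl : (fun n => lift (A n)) = s := funext hA
    obtain ⟨k, hk⟩ : ∃ k, ¬ (lift (A k)).Nonempty := by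
      by_contra! hcon
      exact (nonempty_iInter_lift A hanti hcon).ne_empty hempty
    refine tendsto_const_nhds.congr' ?_
    filter_upwards [eventually_ge_atTop k] with n hn
    have : lift (A n) = ∅ := Set.subset_empty_iff.mp
      ((hanti hn).trans (Set.not_nonempty_iff_eq_empty.mp hk).le)
    simp only [this, addContent_empty]

/-- The Loeb measure. -/
noncomputable def loeb (X : ℕ → Type*) [∀ n, Fintype (X n)] [∀ n, Nonempty (X n)] :
    Measure (Ultra X) :=
  loebContent.measure isSetRing_range_lift.isSetSemiring le_rfl isSigmaSubadditive_loebContent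

theorem loeb_lift (A : Set (Σ n, X n)) : loeb X (lift A) = ulim A := by
  rw [← loebContent_lift]
  exact AddContent.measure_eq loebContent isSetRing_range_lift.isSetSemiring rfl
    isSigmaSubadditive_loebContent (Set.mem_range_self A)

instance : IsProbabilityMeasure (loeb X) :=
  ⟨by rw [← lift_univ, loeb_lift, ulim_univ]⟩

theorem tendsto_freq (A : Set (Σ n, X n)) :
    Tendsto (freq A) (hyperfilter ℕ) (𝓝 ((loeb X).real (lift A))) := by
  have h := (ENNReal.tendsto_toReal (measure_ne_top (loeb X) (lift A))).comp
    ((loeb_lift A).symm ▸ tendsto_ulim A)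
  refine h.congr fun n => ?_
  simp [ENNReal.toReal_ofReal (freq_nonneg _ _)]

end Ultra

/-! ### Finitely generated internal sets and approximation -/

namespace Ultra

section FinGen

variable {X : ℕ → Type*}

/-- `F` is a Boolean combination, uniformly in the fibre, of finitely many sets from `𝒢`. -/
def FinGen (𝒢 : Set (Set (Σ n, X n))) (F : Set (Σ n, X n)) : Prop :=
  ∃ 𝒯 : Set (Set (Σ n, X n)), 𝒯.Finite ∧ 𝒯 ⊆ 𝒢 ∧ ∀ n (x y : X n),
    (∀ T ∈ 𝒯, (⟨n, x⟩ : Σ n, X n) ∈ T ↔ ⟨n, y⟩ ∈ T) → ((⟨n, x⟩ : Σ n, X n) ∈ F ↔ ⟨n, y⟩ ∈ F)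

namespace FinGen

variable {𝒢 ℋ : Set (Set (Σ n, X n))} {F G : Set (Σ n, X n)}

theorem of_mem (h : F ∈ 𝒢) : FinGen 𝒢 F :=
  ⟨{F}, Set.finite_singleton F, by simpa using h, fun _ _ _ h => h F rfl⟩

theorem mono (h : FinGen 𝒢 F) (hle : 𝒢 ⊆ ℋ) : FinGen ℋ F := by
  obtain ⟨𝒯, h1, h2, h3⟩ := h
  exact ⟨𝒯, h1, h2.trans hle, h3⟩

theorem compl (h : FinGen 𝒢 F) : FinGen 𝒢 Fᶜ := by
  obtain ⟨𝒯, h1, h2, h3⟩ := h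
  exact ⟨𝒯, h1, h2, fun n x y hxy => not_congr (h3 n x y hxy)⟩

theorem iInter {ι : Type*} [Finite ι] {F : ι → Set (Σ n, X n)} (h : ∀ i, FinGen 𝒢 (F i)) :
    FinGen 𝒢 (⋂ i, F i) := by
  choose 𝒯 h1 h2 h3 using h
  refine ⟨⋃ i, 𝒯 i, Set.finite_iUnion h1, Set.iUnion_subset h2, fun n x y hxy => ?_⟩
  simp only [Set.mem_iInter]
  exact forall_congr' fun i => h3 i n x y fun T hT => hxy T (Set.mem_iUnion.mpr ⟨i, hT⟩)

theorem univ : FinGen 𝒢 (Set.univ : Set (Σ n, X n)) :=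
  ⟨∅, Set.finite_empty, Set.empty_subset _, fun _ _ _ _ => Iff.rfl⟩

theorem empty : FinGen 𝒢 (∅ : Set (Σ n, X n)) :=
  ⟨∅, Set.finite_empty, Set.empty_subset _, fun _ _ _ _ => Iff.rfl⟩

theorem inter (hF : FinGen 𝒢 F) (hG : FinGen 𝒢 G) : FinGen 𝒢 (F ∩ G) := by
  rw [Set.inter_eq_iInter]
  exact iInter fun b => by cases b <;> assumption

theorem union (hF : FinGen 𝒢 F) (hG : FinGen 𝒢 G) : FinGen 𝒢 (F ∪ G) := by
  rw [← compl_compl (F ∪ G), Set.compl_union]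
  exact (hF.compl.inter hG.compl).compl

end FinGen

/-- The finitely many truth values form a measurable map to a finite space, and `F` is the preimage
of its own image. -/
theorem measurableSet_of_determined {α β : Type*} [Finite β] (m : MeasurableSpace α)
    (T : β → Set α) (hT : ∀ b, MeasurableSet[m] (T b)) {F : Set α}
    (hF : ∀ x y, (∀ b, x ∈ T b ↔ y ∈ T b) → (x ∈ F ↔ y ∈ F)) : MeasurableSet[m] F := by
  let φ : α → β → Prop := fun x b => x ∈ T b
  have hφ : Measurable[m] φ := measurable_pi_iff.mpr fun b => measurableSet_setOfPred.mp (hT b)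
  have : F = φ ⁻¹' (φ '' F) := by
    ext x
    refine ⟨fun hx => ⟨x, hx, rfl⟩, ?_⟩
    rintro ⟨y, hy, hyx⟩
    exact (hF x y fun b => (Eq.to_iff (congrFun hyx b)).symm).mpr hy
  rw [this]
  exact hφ (Set.toFinite _).measurableSet

/-- The σ-algebra generated by the internal sets given by the members of `𝒢`. -/
@[reducible]
def sigOf (𝒢 : Set (Set (Σ n, X n))) : MeasurableSpace (Ultra X) :=
  MeasurableSpace.generateFrom (lift '' 𝒢)

variable {𝒢 ℋ : Set (Set (Σ n, X n))} {F : Set (Σ n, X n)}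

theorem sigOf_mono (h : 𝒢 ⊆ ℋ) : sigOf 𝒢 ≤ sigOf ℋ :=
  MeasurableSpace.generateFrom_mono (Set.image_mono h)

theorem sigOf_le (𝒢 : Set (Set (Σ n, X n))) : sigOf 𝒢 ≤ instMeasurableSpace :=
  MeasurableSpace.generateFrom_mono (Set.image_subset_range _ _)

/-- Two points that agree on the lifts of finitely many sets agree on all of those sets in almost
every fibre simultaneously. -/
theorem FinGen.measurableSet_lift (h : FinGen 𝒢 F) : MeasurableSet[sigOf 𝒢] (lift F) := by
  obtain ⟨𝒯, h1, h2, h3⟩ := h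
  have := h1.to_subtype
  refine measurableSet_of_determined (sigOf 𝒢) (fun T : 𝒯 => lift T.1)
    (fun T => MeasurableSpace.measurableSet_generateFrom ⟨T.1, h2 T.2, rfl⟩) fun x y hxy => ?_
  have key : ∀ T : 𝒯, ∀ᶠ n in hyperfilter ℕ,
      ((⟨n, x n⟩ : Σ n, X n) ∈ T.1 ↔ (⟨n, y n⟩ : Σ n, X n) ∈ T.1) := by
    intro T
    by_cases hx : x ∈ lift T.1
    · filter_upwards [hx, (hxy T).mp hx] with n h1 h2
      exact iff_of_true h1 h2
    · have hy := mt (hxy T).mpr hx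
      rw [← Set.mem_compl_iff, ← lift_compl] at hx hy
      filter_upwards [hx, hy] with n h1 h2
      exact iff_of_false h1 h2
  have key2 := eventually_all.mpr key
  constructor
  · intro hx
    filter_upwards [key2, hx] with n hn hx
    exact (h3 n _ _ fun T hT => hn ⟨T, hT⟩).mp hx
  · intro hx
    filter_upwards [key2, hx] with n hn hx
    exact (h3 n _ _ fun T hT => hn ⟨T, hT⟩).mpr hx

theorem sigOf_eq_generateFrom (𝒢 : Set (Set (Σ n, X n))) :
    sigOf 𝒢 = MeasurableSpace.generateFrom (lift '' {F | FinGen 𝒢 F}) := by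
  refine le_antisymm (MeasurableSpace.generateFrom_mono
    (Set.image_mono fun F hF => FinGen.of_mem hF)) (MeasurableSpace.generateFrom_le ?_)
  rintro _ ⟨F, hF, rfl⟩
  exact FinGen.measurableSet_lift hF

theorem isSetRing_finGen (𝒢 : Set (Set (Σ n, X n))) : IsSetRing (lift '' {F | FinGen 𝒢 F}) where
  empty_mem := ⟨∅, FinGen.empty, lift_empty⟩
  union_mem := by
    rintro _ _ ⟨A, hA, rfl⟩ ⟨B, hB, rfl⟩
    exact ⟨A ∪ B, hA.union hB, lift_union A B⟩
  sdiff_mem := by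
    rintro _ _ ⟨A, hA, rfl⟩ ⟨B, hB, rfl⟩
    refine ⟨A \ B, ?_, lift_diff A B⟩
    rw [Set.sdiff_eq]
    exact hA.inter hB.compl

variable [∀ n, Fintype (X n)] [∀ n, Nonempty (X n)]

theorem exists_finGen_approx {D : Set (Ultra X)} (hD : MeasurableSet[sigOf 𝒢] D) {ε : ℝ}
    (hε : 0 < ε) : ∃ F, FinGen 𝒢 F ∧ (loeb X).real (symmDiff (lift F) D) < ε := by
  have hm := sigOf_le 𝒢
  obtain ⟨_, ⟨F, hF, rfl⟩, hlt⟩ :=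
    @exists_measure_symmDiff_lt_of_generateFrom_isSetRing _ (sigOf 𝒢) ((loeb X).trim hm) _ _
      (isSetRing_finGen 𝒢) ⟨{Set.univ}, Set.countable_singleton _, by
        simpa using ⟨Set.univ, FinGen.univ, lift_univ⟩, by simp⟩
      (sigOf_eq_generateFrom 𝒢) D hD (ENNReal.ofReal ε) (by simpa using hε)
  refine ⟨F, hF, ?_⟩
  rw [trim_measurableSet_eq hm (hF.measurableSet_lift.symmDiff hD)] at hlt
  exact (ENNReal.toReal_lt_of_lt_ofReal hlt)

/-- `f` is the standard part of the internal function `F`, in the sense of integrals over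
internal sets. -/
def Represents (f : Ultra X → ℝ) (F : ∀ n, X n → ℝ) : Prop :=
  ∀ G : Set (Σ n, X n), Tendsto (fun n => avg fun x => F n x * G.indicator (fun _ => (1 : ℝ)) ⟨n, x⟩)
    (hyperfilter ℕ) (𝓝 (∫ x in lift G, f x ∂(loeb X)))

theorem represents_indicator (c : ℝ) (Q : Set (Σ n, X n)) :
    Represents ((lift Q).indicator fun _ => c)
      (fun n x => c * Q.indicator (fun _ => (1 : ℝ)) ⟨n, x⟩) := by
  intro G
  rw [integral_indicator (measurableSet_lift Q), Measure.restrict_restrict (measurableSet_lift Q),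
    ← lift_inter, setIntegral_const, smul_eq_mul, mul_comm]
  refine ((tendsto_freq (Q ∩ G)).const_mul c).congr fun n => ?_
  rw [freq, ← avg_const_mul]
  congr 1
  ext x
  rw [mul_assoc]
  congr 1
  by_cases h1 : (⟨n, x⟩ : Σ n, X n) ∈ Q <;> by_cases h2 : (⟨n, x⟩ : Σ n, X n) ∈ G <;>
    simp [h1, h2]

theorem Represents.add {f g : Ultra X → ℝ} {F G : ∀ n, X n → ℝ} (hf : Represents f F)
    (hg : Represents g G) (hfi : Integrable f (loeb X)) (hgi : Integrable g (loeb X)) :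
    Represents (f + g) (fun n x => F n x + G n x) := by
  intro D
  have : ∫ x in lift D, (f + g) x ∂(loeb X) =
      ∫ x in lift D, f x ∂(loeb X) + ∫ x in lift D, g x ∂(loeb X) :=
    integral_add hfi.integrableOn hgi.integrableOn
  rw [this]
  refine ((hf D).add (hg D)).congr fun n => ?_
  simp only [add_mul, avg_add]

/-- Functions on the fibres that do not separate points indistinguishable by `𝒢`. -/
def Respects (𝒢 : Set (Set (Σ n, X n))) (F : ∀ n, X n → ℝ) : Prop :=
  ∀ n (x y : X n), (∀ T ∈ 𝒢, (⟨n, x⟩ : Σ n, X n) ∈ T ↔ ⟨n, y⟩ ∈ T) → F n x = F n y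

theorem coe_piecewise_const {α : Type*} [MeasurableSpace α] (c : ℝ) {s : Set α}
    (hs : MeasurableSet s) :
    ⇑(SimpleFunc.piecewise s hs (SimpleFunc.const α c) (SimpleFunc.const α 0)) =
      s.indicator fun _ => c := by
  ext x
  by_cases hx : x ∈ s <;> simp [hx]

/-- Simple functions are dense, and each of their level sets is close to a finitely generated
internal set; the approximant thus comes from functions on the fibres that see only `𝒢`. -/
theorem exists_represents_approx {f : Ultra X → ℝ} (hf : Integrable f (loeb X))
    (hfm : StronglyMeasurable[sigOf 𝒢] f) {ε : ℝ} (hε : 0 < ε) :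
    ∃ (g : Ultra X → ℝ) (F : ∀ n, X n → ℝ), Integrable g (loeb X) ∧ Represents g F ∧
      Respects 𝒢 F ∧ ∫ x, |f x - g x| ∂(loeb X) ≤ ε := by
  have hm := sigOf_le 𝒢
  have hsimple : ∀ s : @SimpleFunc (Ultra X) (sigOf 𝒢) ℝ, ∀ ε > 0,
      Integrable s (loeb X) ∧ ∃ (g : Ultra X → ℝ) (F : ∀ n, X n → ℝ), Integrable g (loeb X) ∧
        Represents g F ∧ Respects 𝒢 F ∧ ∫ x, |s x - g x| ∂(loeb X) ≤ ε := by
    intro s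
    refine @SimpleFunc.induction (Ultra X) ℝ (sigOf 𝒢) _ (fun s => ∀ ε > 0,
      Integrable s (loeb X) ∧ ∃ (g : Ultra X → ℝ) (F : ∀ n, X n → ℝ), Integrable g (loeb X) ∧
        Represents g F ∧ Respects 𝒢 F ∧ ∫ x, |s x - g x| ∂(loeb X) ≤ ε) ?_ ?_ s
    · intro c D hD ε hε
      have hint : ∀ {D : Set (Ultra X)}, MeasurableSet D →
          Integrable (D.indicator fun _ => c) (loeb X) :=
        fun hD => (integrable_const c).indicator hD
      -- The added 1 in the denominator allows for `c = 0`.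
      obtain ⟨Q, hQ, hlt⟩ := exists_finGen_approx hD (ε := ε / (|c| + 1)) (by positivity)
      rw [@coe_piecewise_const _ (sigOf 𝒢) c D hD]
      refine ⟨hint (hm _ hD), _, _, hint (measurableSet_lift Q), represents_indicator c Q, ?_, ?_⟩
      · intro n x y hxy
        obtain ⟨𝒯, -, h2, h3⟩ := hQ
        have := h3 n x y fun T hT => hxy T (h2 hT)
        by_cases hx : (⟨n, x⟩ : Σ n, X n) ∈ Q
        · simp [hx, this.mp hx]
        · simp [hx, mt this.mpr hx]
      · have hfun : (fun x => |D.indicator (fun _ => c) x - (lift Q).indicator (fun _ => c) x|) =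
            (symmDiff (lift Q) D).indicator fun _ => |c| := by
          ext x
          by_cases h1 : x ∈ D <;> by_cases h2 : x ∈ lift Q <;> simp [h1, h2, Set.mem_symmDiff]
        rw [hfun, integral_indicator ((measurableSet_lift Q).symmDiff (hm _ hD)), setIntegral_const,
          smul_eq_mul]
        calc _ ≤ ε / (|c| + 1) * (|c| + 1) := by gcongr; linarith
          _ = ε := by field_simp
    · intro s t _ hs ht ε hε
      obtain ⟨hsi, g1, F1, hg1, hr1, hR1, h1⟩ := hs (ε / 2) (by positivity)
      obtain ⟨hti, g2, F2, hg2, hr2, hR2, h2⟩ := ht (ε / 2) (by positivity)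
      refine ⟨hsi.add hti, g1 + g2, _, hg1.add hg2, hr1.add hr2 hg1 hg2, ?_, ?_⟩
      · intro n x y hxy
        simp only [hR1 n x y hxy, hR2 n x y hxy]
      · calc _ ≤ ∫ x, (|s x - g1 x| + |t x - g2 x|) ∂(loeb X) := by
              refine integral_mono ((hsi.add hti).sub (hg1.add hg2)).abs
                ((hsi.sub hg1).abs.add (hti.sub hg2).abs) fun x => ?_
              have := abs_add_le (s x - g1 x) (t x - g2 x)
              simpa [add_sub_add_comm] using this
          _ = ∫ x, |s x - g1 x| ∂(loeb X) + ∫ x, |t x - g2 x| ∂(loeb X) :=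
              integral_add (hsi.sub hg1).abs (hti.sub hg2).abs
          _ ≤ ε := by linarith
  have hmem := memLp_one_iff_integrable.mpr (hf.trim hm hfm)
  obtain ⟨s, hs, -⟩ := @MemLp.exists_simpleFunc_eLpNorm_sub_lt _ (sigOf 𝒢) 1 ℝ _ f _ hmem
    ENNReal.one_ne_top (ENNReal.ofReal (ε / 2)) (by simpa using hε)
  obtain ⟨hsi, g, F, hg, hr, hR, h1⟩ := hsimple s (ε / 2) (by positivity)
  refine ⟨g, F, hg, hr, hR, ?_⟩
  have hfs : ∫ x, |f x - s x| ∂(loeb X) ≤ ε / 2 := by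
    rw [eLpNorm_trim hm (hfm.sub (@SimpleFunc.stronglyMeasurable _ _ (sigOf 𝒢) _ s)),
      eLpNorm_one_eq_lintegral_enorm] at hs
    have := integral_norm_eq_lintegral_enorm (hf.sub hsi).aestronglyMeasurable
    simp only [Real.norm_eq_abs, Pi.sub_apply] at this hs
    rw [this]
    exact (ENNReal.toReal_lt_of_lt_ofReal hs).le
  calc _ ≤ ∫ x, (|f x - s x| + |s x - g x|) ∂(loeb X) :=
        integral_mono (hf.sub hg).abs ((hf.sub hsi).abs.add (hsi.sub hg).abs)
          fun x => abs_sub_le _ _ _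
    _ = ∫ x, |f x - s x| ∂(loeb X) + ∫ x, |s x - g x| ∂(loeb X) :=
        integral_add (hf.sub hsi).abs (hsi.sub hg).abs
    _ ≤ ε := by linarith

end FinGen

end Ultra

/-! ### Vanishing of integrals tested on a π-system -/

section PiSystem

variable {α : Type*} [m0 : MeasurableSpace α] {μ : Measure α} {f : α → ℝ}

theorem setIntegral_eq_zero_of_generateFrom {P : Set (Set α)} {m : MeasurableSpace α} (hm : m ≤ m0)
    (h_eq : m = MeasurableSpace.generateFrom P) (hP : IsPiSystem P) (huniv : Set.univ ∈ P)
    (hf : Integrable f μ) (h : ∀ s ∈ P, ∫ x in s, f x ∂μ = 0) {t : Set α}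
    (ht : MeasurableSet[m] t) : ∫ x in t, f x ∂μ = 0 := by
  have h0 : ∫ x, f x ∂μ = 0 := by simpa using h _ huniv
  refine MeasurableSpace.induction_on_inter (C := fun t _ => ∫ x in t, f x ∂μ = 0) h_eq hP
    (by simp) h ?_ ?_ t ht
  · intro t htm ht0
    have := integral_add_compl (hm _ htm) hf
    rw [ht0, h0, zero_add] at this
    exact this
  · intro g hdisj hgm hg
    rw [integral_iUnion (fun i => hm _ (hgm i)) hdisj hf.integrableOn]
    simp [hg]

theorem setIntegral_eq_zero_of_sup {m₁ m₂ : MeasurableSpace α} (h₁ : m₁ ≤ m0) (h₂ : m₂ ≤ m0)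
    (hf : Integrable f μ)
    (h : ∀ s t, MeasurableSet[m₁] s → MeasurableSet[m₂] t → ∫ x in s ∩ t, f x ∂μ = 0) {t : Set α}
    (ht : MeasurableSet[m₁ ⊔ m₂] t) : ∫ x in t, f x ∂μ = 0 := by
  refine setIntegral_eq_zero_of_generateFrom (m0 := m0) (m := m₁ ⊔ m₂)
    (P := {u | ∃ s t, MeasurableSet[m₁] s ∧ MeasurableSet[m₂] t ∧ s ∩ t = u})
    (sup_le h₁ h₂) (le_antisymm (sup_le ?_ ?_) ?_) ?_ ?_ hf ?_ ht
  · exact fun s hs => MeasurableSpace.measurableSet_generateFrom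
      ⟨s, Set.univ, hs, MeasurableSet.univ, Set.inter_univ s⟩
  · exact fun s hs => MeasurableSpace.measurableSet_generateFrom
      ⟨Set.univ, s, MeasurableSet.univ, hs, Set.univ_inter s⟩
  · refine MeasurableSpace.generateFrom_le ?_
    rintro _ ⟨s, t, hs, ht, rfl⟩
    exact MeasurableSet.inter ((le_sup_left : m₁ ≤ m₁ ⊔ m₂) _ hs)
      ((le_sup_right : m₂ ≤ m₁ ⊔ m₂) _ ht)
  · rintro _ ⟨s, t, hs, ht, rfl⟩ _ ⟨s', t', hs', ht', rfl⟩ -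
    exact ⟨s ∩ s', t ∩ t', hs.inter hs', ht.inter ht', Set.inter_inter_inter_comm _ _ _ _⟩
  · exact ⟨Set.univ, Set.univ, MeasurableSet.univ, MeasurableSet.univ, Set.inter_univ _⟩
  · rintro _ ⟨s, t, hs, ht, rfl⟩
    exact h s t hs ht

end PiSystem

/-! ### Freezing coordinates in a finite product -/

section Slice

variable {J : Type u} [DecidableEq J]

/-- Exchanging the coordinates outside `e` between two points. -/
def piecewiseSwap (e : Finset J) (W : J → Type v) :
    Equiv.Perm ((∀ j, W j) × ∀ j, W j) :=
  Function.Involutive.toPerm (fun p => (e.piecewise p.1 p.2, e.piecewise p.2 p.1)) fun p => by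
    ext j <;> by_cases hj : j ∈ e <;> simp [hj]

variable [Fintype J] {W : J → Type v} [∀ j, Fintype (W j)] [∀ j, Nonempty (W j)]

/-- Swapping the coordinates outside `e` permutes the pairs of points, so the mixture of two
independent uniform points is uniform. -/
theorem avg_avg_piecewise (e : Finset J) (h : (∀ j, W j) → ℝ) :
    (avg fun y => avg fun x => h (e.piecewise x y)) = avg h := by
  have key : ∑ p : (∀ j, W j) × (∀ j, W j), h (e.piecewise p.1 p.2) =
      ∑ p : (∀ j, W j) × (∀ j, W j), h p.1 :=
    Equiv.sum_comp (piecewiseSwap e W) fun p => h p.1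
  rw [Fintype.sum_prod_type_right, Fintype.sum_prod_type_right] at key
  simp only [avg, ← Finset.sum_div, key, Finset.sum_const, Finset.card_univ, nsmul_eq_mul]
  have : (Fintype.card (∀ j, W j) : ℝ) ≠ 0 := Nat.cast_ne_zero.mpr Fintype.card_ne_zero
  field_simp

theorem exists_abs_avg_le_piecewise (e : Finset J) (h : (∀ j, W j) → ℝ) :
    ∃ y : ∀ j, W j, |avg h| ≤ |avg fun x => h (e.piecewise x y)| := by
  obtain ⟨y, -, hy⟩ := Finset.exists_max_image Finset.univ
    (fun y : ∀ j, W j => |avg fun x => h (e.piecewise x y)|) Finset.univ_nonempty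
  refine ⟨y, ?_⟩
  calc |avg h| = |avg fun y => avg fun x => h (e.piecewise x y)| := by rw [avg_avg_piecewise]
    _ ≤ avg fun y => |avg fun x => h (e.piecewise x y)| := abs_avg_le _
    _ ≤ avg fun _ : ∀ j, W j => |avg fun x => h (e.piecewise x y)| :=
        avg_mono fun z => hy z (Finset.mem_univ z)
    _ = _ := avg_const _

end Slice

/-! ### Coordinate σ-algebras and orthogonality -/

namespace Ultra

variable {J : Type u} {V : ℕ → J → Type v}

/-- Membership in `T` depends only on the coordinates in `e`. -/
def IsLocal (e : Finset J) (T : Set (Σ n, ∀ j, V n j)) : Prop :=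
  ∀ n (x y : ∀ j, V n j), (∀ j ∈ e, x j = y j) →
    ((⟨n, x⟩ : Σ n, ∀ j, V n j) ∈ T ↔ (⟨n, y⟩ : Σ n, ∀ j, V n j) ∈ T)

/-- The sets depending only on the coordinates in some member of `𝓢`. -/
def loc (V : ℕ → J → Type v) (𝓢 : Set (Finset J)) : Set (Set (Σ n, ∀ j, V n j)) :=
  {T | ∃ e ∈ 𝓢, IsLocal e T}

/-- The σ-algebra of the ultraproduct generated by the coordinates in the members of `𝓢`. -/
@[reducible]
def sig (V : ℕ → J → Type v) (𝓢 : Set (Finset J)) : MeasurableSpace (Ultra fun n => ∀ j, V n j) :=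
  sigOf (loc V 𝓢)

theorem IsLocal.mono {e e' : Finset J} (h : e ⊆ e') {T : Set (Σ n, ∀ j, V n j)}
    (hT : IsLocal e T) : IsLocal e' T :=
  fun n x y hxy => hT n x y fun j hj => hxy j (h hj)

theorem loc_mono {𝓢 𝓢' : Set (Finset J)} (h : ∀ e ∈ 𝓢, ∃ e' ∈ 𝓢', e ⊆ e') :
    loc V 𝓢 ⊆ loc V 𝓢' := by
  rintro T ⟨e, he, hT⟩
  obtain ⟨e', he', hle⟩ := h e he
  exact ⟨e', he', hT.mono hle⟩

theorem sig_mono {𝓢 𝓢' : Set (Finset J)} (h : ∀ e ∈ 𝓢, ∃ e' ∈ 𝓢', e ⊆ e') :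
    sig V 𝓢 ≤ sig V 𝓢' :=
  sigOf_mono (loc_mono h)

theorem sig_le (𝓢 : Set (Finset J)) : sig V 𝓢 ≤ instMeasurableSpace := sigOf_le _

theorem IsLocal.measurableSet_lift {e : Finset J} {T : Set (Σ n, ∀ j, V n j)} (hT : IsLocal e T)
    {𝓢 : Set (Finset J)} (he : e ∈ 𝓢) : MeasurableSet[sig V 𝓢] (lift T) :=
  MeasurableSpace.measurableSet_generateFrom ⟨T, ⟨e, he, hT⟩, rfl⟩

variable [DecidableEq J]

/-- Freezing the coordinates outside `e` to those of `y`. -/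
def slice (e : Finset J) (y : ∀ n j, V n j) (G : Set (Σ n, ∀ j, V n j)) :
    Set (Σ n, ∀ j, V n j) :=
  {p | ⟨p.1, e.piecewise p.2 (y p.1)⟩ ∈ G}

/-- The traces on `e` of the members of `𝓢`. -/
def traces (e : Finset J) (𝓢 : Set (Finset J)) : Set (Finset J) := (fun e' => e' ∩ e) '' 𝓢

theorem IsLocal.slice {e e' : Finset J} {T : Set (Σ n, ∀ j, V n j)} (hT : IsLocal e' T)
    (y : ∀ n j, V n j) : IsLocal (e' ∩ e) (slice e y T) := by
  intro n x z hxz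
  refine hT n _ _ fun j hj => ?_
  by_cases hje : j ∈ e
  · simpa [hje] using hxz j (Finset.mem_inter.mpr ⟨hj, hje⟩)
  · simp [hje]

theorem FinGen.slice {𝓢 : Set (Finset J)} {G : Set (Σ n, ∀ j, V n j)} (hG : FinGen (loc V 𝓢) G)
    (e : Finset J) (y : ∀ n j, V n j) : FinGen (loc V (traces e 𝓢)) (slice e y G) := by
  obtain ⟨𝒯, h1, h2, h3⟩ := hG
  refine ⟨Ultra.slice e y '' 𝒯, h1.image _, ?_, fun n x z hxz => h3 n _ _ fun T hT => ?_⟩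
  · rintro _ ⟨T, hT, rfl⟩
    obtain ⟨e', he', hT'⟩ := h2 hT
    exact ⟨e' ∩ e, ⟨e', he', rfl⟩, hT'.slice y⟩
  · exact hxz _ ⟨T, hT, rfl⟩

variable [Fintype J] [∀ n j, Fintype (V n j)] [∀ n j, Nonempty (V n j)]

/-- In each fibre some choice of frozen coordinates does at least as well as the average. Freezing
affects only `G`, since `F` depends on the coordinates in `e` alone. -/
theorem abs_setIntegral_slice_le {e : Finset J} {f : (Ultra fun n => ∀ j, V n j) → ℝ}
    {F : ∀ n, (∀ j, V n j) → ℝ} (hf : Represents f F) (hF : Respects (loc V {e}) F)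
    (G : Set (Σ n, ∀ j, V n j)) : ∃ y : ∀ n j, V n j,
      |∫ x in lift G, f x ∂(loeb fun n => ∀ j, V n j)| ≤
        |∫ x in lift (slice e y G), f x ∂(loeb fun n => ∀ j, V n j)| := by
  choose y hy using fun n => exists_abs_avg_le_piecewise e
    fun x : ∀ j, V n j => F n x * G.indicator (fun _ => (1 : ℝ)) ⟨n, x⟩
  refine ⟨y, le_of_tendsto_of_tendsto' (hf G).abs (hf (slice e y G)).abs fun n =>
    (hy n).trans_eq ?_⟩
  congr 2
  ext x
  congr 1
  refine hF n _ _ ?_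
  rintro T ⟨e', rfl, hT⟩
  exact hT n _ _ fun j hj => by simp [hj]

/-- Up to ε, the integral over `G` is bounded by that over a slice of `G`, which lies in the
σ-algebra of the traces and so contributes zero. -/
theorem setIntegral_finGen_eq_zero {e : Finset J} {𝓢 : Set (Finset J)}
    {f : (Ultra fun n => ∀ j, V n j) → ℝ} (hf : Integrable f (loeb _))
    (hfm : StronglyMeasurable[sig V {e}] f)
    (h : ∀ D, MeasurableSet[sig V (traces e 𝓢)] D → ∫ x in D, f x ∂(loeb _) = 0)
    {G : Set (Σ n, ∀ j, V n j)} (hG : FinGen (loc V 𝓢) G) :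
    ∫ x in lift G, f x ∂(loeb _) = 0 := by
  refine abs_nonpos_iff.mp (le_of_forall_pos_le_add fun ε hε => ?_)
  obtain ⟨g, F, hg, hgF, hF, hfg⟩ := exists_represents_approx hf hfm (half_pos hε)
  have hdiff : ∀ D : Set (Ultra fun n => ∀ j, V n j),
      |∫ x in D, f x ∂(loeb _) - ∫ x in D, g x ∂(loeb _)| ≤ ε / 2 := by
    intro D
    rw [← integral_sub hf.integrableOn hg.integrableOn]
    exact (abs_integral_le_integral_abs).trans
      ((setIntegral_le_integral (hf.sub hg).abs (ae_of_all _ fun _ => abs_nonneg _)).trans hfg)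
  obtain ⟨y, hy⟩ := abs_setIntegral_slice_le hgF hF G
  have h1 := hdiff (lift G)
  have h2 := hdiff (lift (slice e y G))
  rw [h _ (hG.slice e y).measurableSet_lift, zero_sub, abs_neg] at h2
  have h3 := abs_sub_abs_le_abs_sub (∫ x in lift G, f x ∂(loeb _)) (∫ x in lift G, g x ∂(loeb _))
  linarith

/-- A function of the coordinates in `e` which is orthogonal to the σ-algebra of the traces on `e`
of the members of `𝓢` is orthogonal to the σ-algebra of `𝓢`. -/
theorem setIntegral_eq_zero_of_traces {e : Finset J} {𝓢 : Set (Finset J)}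
    {f : (Ultra fun n => ∀ j, V n j) → ℝ} (hf : Integrable f (loeb _))
    (hfm : StronglyMeasurable[sig V {e}] f)
    (h : ∀ D, MeasurableSet[sig V (traces e 𝓢)] D → ∫ x in D, f x ∂(loeb _) = 0)
    {G : Set (Ultra fun n => ∀ j, V n j)} (hG : MeasurableSet[sig V 𝓢] G) :
    ∫ x in G, f x ∂(loeb _) = 0 := by
  refine setIntegral_eq_zero_of_generateFrom (sig_le 𝓢) (sigOf_eq_generateFrom _)
    (isSetRing_finGen _).isSetSemiring.isPiSystem ⟨Set.univ, FinGen.univ, lift_univ⟩ hf ?_ hG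
  rintro _ ⟨F, hF, rfl⟩
  exact setIntegral_finGen_eq_zero hf hfm h hF

/-- A set of `𝓒` can be absorbed into the integrand as an indicator, which leaves it a function on
`e`. -/
theorem setIntegral_eq_zero_of_sup_traces {e : Finset J} {𝓢 : Set (Finset J)}
    {𝓒 : MeasurableSpace (Ultra fun n => ∀ j, V n j)} (h𝓒 : 𝓒 ≤ sig V {e})
    {f : (Ultra fun n => ∀ j, V n j) → ℝ} (hf : Integrable f (loeb _))
    (hfm : StronglyMeasurable[sig V {e}] f)
    (h : ∀ D, MeasurableSet[𝓒 ⊔ sig V (traces e 𝓢)] D → ∫ x in D, f x ∂(loeb _) = 0)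
    {G : Set (Ultra fun n => ∀ j, V n j)} (hG : MeasurableSet[𝓒 ⊔ sig V 𝓢] G) :
    ∫ x in G, f x ∂(loeb _) = 0 := by
  refine setIntegral_eq_zero_of_sup (m0 := instMeasurableSpace) (h𝓒.trans (sig_le _)) (sig_le _) hf ?_ hG
  intro s t hs ht
  have hs' := h𝓒 _ hs
  have hs0 := sig_le _ _ hs'
  rw [Set.inter_comm, ← setIntegral_indicator hs0]
  refine setIntegral_eq_zero_of_traces (e := e) (hf.indicator hs0) (hfm.indicator hs') ?_ ht
  intro D hD
  rw [setIntegral_indicator hs0]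
  exact h _ (MeasurableSet.inter ((le_sup_right : _ ≤ 𝓒 ⊔ sig V (traces e 𝓢)) _ hD)
    ((le_sup_left : _ ≤ 𝓒 ⊔ sig V (traces e 𝓢)) _ hs))

end Ultra

/-! ### Conditional probabilities -/

section CondExp

variable {α : Type*} {m m0 : MeasurableSpace α} {μ : Measure α}

theorem condExp_indicator_nonneg (E : Set α) :
    0 ≤ᵐ[μ] μ[E.indicator fun _ => (1 : ℝ) | m] :=
  condExp_nonneg (ae_of_all _ fun _ => Set.indicator_nonneg (fun _ _ => zero_le_one) _)

/-- The set where the conditional probability of `E` is positive. -/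
def condPos (μ : Measure α) (m : MeasurableSpace α) (E : Set α) : Set α :=
  {x | 0 < (μ[E.indicator fun _ => (1 : ℝ) | m]) x}

theorem measurableSet_condPos (E : Set α) : MeasurableSet[m] (condPos μ m E) :=
  @measurableSet_lt _ _ _ _ _ m _ _ _ _ _ (@measurable_const _ _ _ m 0)
    stronglyMeasurable_condExp.measurable

theorem measure_condPos_inter_eq_zero {E R : Set α} (hR : MeasurableSet[m0] R)
    (h : ∫ x in R, (μ[E.indicator fun _ => (1 : ℝ) | m]) x ∂μ = 0) :
    μ (condPos μ m E ∩ R) = 0 := by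
  rw [setIntegral_eq_zero_iff_of_nonneg_ae (ae_restrict_of_ae (condExp_indicator_nonneg E))
    integrable_condExp.integrableOn, EventuallyEq, ae_restrict_iff' hR] at h
  refine measure_mono_null (fun x hx => ?_) (ae_iff.mp h)
  exact fun hcon => hx.1.ne' (hcon hx.2)

variable [IsProbabilityMeasure μ]

theorem integrable_indicator_one {E : Set α} (hE : MeasurableSet E) :
    Integrable (E.indicator fun _ => (1 : ℝ)) μ :=
  (integrable_const 1).indicator hE

theorem setIntegral_condExp_indicator (hm : m ≤ m0) {E D : Set α} (hE : MeasurableSet[m0] E)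
    (hD : MeasurableSet[m] D) :
    ∫ x in D, (μ[E.indicator fun _ => (1 : ℝ) | m]) x ∂μ = μ.real (D ∩ E) := by
  rw [setIntegral_condExp hm (integrable_indicator_one hE) hD, setIntegral_indicator hE,
    setIntegral_const, smul_eq_mul, mul_one]

theorem measureReal_diff_condPos (hm : m ≤ m0) {E : Set α} (hE : MeasurableSet[m0] E) :
    μ.real (E \ condPos μ m E) = 0 := by
  have hD := (measurableSet_condPos (μ := μ) (m := m) E).compl
  refine le_antisymm ?_ measureReal_nonneg
  rw [Set.sdiff_eq, Set.inter_comm, ← setIntegral_condExp_indicator hm hE hD]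
  exact setIntegral_nonpos (hm _ hD) fun x hx => not_lt.mp hx

/-- Markov's inequality on `Q`: where the conditional probability of `Eᶜ` is at least `t`, a
proportion at least `t` of `Q` lies in `Q \ E`. The part of `E` outside `Q` costs another `η`. -/
theorem measureReal_diff_condExp_lt_le (hm : m ≤ m0) {E Q : Set α} (hE : MeasurableSet[m0] E)
    (hQ : MeasurableSet[m] Q) {η t : ℝ} (ht : 0 < t) (hη : μ.real (symmDiff Q E) ≤ η) :
    μ.real (E \ {x | (μ[Eᶜ.indicator fun _ => (1 : ℝ) | m]) x < t}) ≤ η / t + η := by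
  set q := μ[Eᶜ.indicator fun _ => (1 : ℝ) | m] with hq
  set W : Set α := {x | q x < t}ᶜ with hW
  have hWm : MeasurableSet[m] W := by
    refine MeasurableSet.compl ?_
    exact @measurableSet_lt _ _ _ _ _ m _ _ _ _ _ stronglyMeasurable_condExp.measurable
      (@measurable_const _ _ _ m t)
  have hQW : MeasurableSet[m] (Q ∩ W) := hQ.inter hWm
  have h1 : t * μ.real (Q ∩ W) ≤ η := by
    calc t * μ.real (Q ∩ W) = ∫ x in Q ∩ W, t ∂μ := by
          rw [setIntegral_const, smul_eq_mul, mul_comm]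
      _ ≤ ∫ x in Q ∩ W, q x ∂μ :=
          setIntegral_mono_on (integrable_const t).integrableOn integrable_condExp.integrableOn
            (hm _ hQW) fun x hx => not_lt.mp hx.2
      _ = μ.real (Q ∩ W ∩ Eᶜ) := setIntegral_condExp_indicator hm hE.compl hQW
      _ ≤ μ.real (symmDiff Q E) := measureReal_mono fun x hx => Or.inl ⟨hx.1.1, hx.2⟩
      _ ≤ η := hη
  calc μ.real (E \ {x | q x < t}) ≤ μ.real ((Q ∩ W) ∪ symmDiff Q E) := by
        refine measureReal_mono fun x hx => ?_
        by_cases hxQ : x ∈ Q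
        · exact Or.inl ⟨hxQ, hx.2⟩
        · exact Or.inr (Or.inr ⟨hx.1, hxQ⟩)
    _ ≤ μ.real (Q ∩ W) + μ.real (symmDiff Q E) := measureReal_union_le _ _
    _ ≤ η / t + η := by
        gcongr
        rw [le_div_iff₀ ht, mul_comm]
        exact h1

/-- If a set `N` has small relative complement in each of the `E i`, then `⋂ i, E i` is not null
unless `N` is. -/
theorem measure_eq_zero_of_small_diff {ι : Type*} [Fintype ι] {E : ι → Set α} {N : Set α}
    (hE : μ (⋂ i, E i) = 0)
    (hN : ∀ i, μ.real (N ∩ (E i)ᶜ) ≤ 1 / ((Fintype.card ι : ℝ) + 1) * μ.real N) : μ N = 0 := by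
  have h1 : μ.real N ≤ μ.real (⋂ i, E i) + ∑ i, μ.real (N ∩ (E i)ᶜ) := by
    refine (measureReal_mono (s₂ := (⋂ i, E i) ∪ ⋃ i, N ∩ (E i)ᶜ) fun x hx => ?_).trans
      ((measureReal_union_le _ _).trans (by gcongr; exact measureReal_iUnion_fintype_le _))
    by_cases hxE : ∀ i, x ∈ E i
    · exact Or.inl (Set.mem_iInter.mpr hxE)
    · push Not at hxE
      obtain ⟨i, hi⟩ := hxE
      exact Or.inr (Set.mem_iUnion.mpr ⟨i, hx, hi⟩)
  have h2 : ∑ i, μ.real (N ∩ (E i)ᶜ) ≤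
      Fintype.card ι * (1 / ((Fintype.card ι : ℝ) + 1) * μ.real N) :=
    (Finset.sum_le_sum fun i _ => hN i).trans_eq (by simp)
  have h3 : μ.real (⋂ i, E i) = 0 := by simp [Measure.real, hE]
  have h4 : (Fintype.card ι : ℝ) * (1 / ((Fintype.card ι : ℝ) + 1) * μ.real N) =
      μ.real N - μ.real N / ((Fintype.card ι : ℝ) + 1) := by
    field_simp
    ring
  have h5 : μ.real N / ((Fintype.card ι : ℝ) + 1) ≤ 0 := by linarith
  have h6 : μ.real N ≤ 0 := by
    by_contra! hpos
    exact absurd h5 (not_le.mpr (by positivity))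
  exact (measureReal_eq_zero_iff).mp (le_antisymm h6 measureReal_nonneg)

theorem exists_inter_eq_of_generateFrom {α : Type*} {P : Set (Set α)} {m' : MeasurableSpace α}
    {A : Set α} (h : ∀ s ∈ P, ∃ D', MeasurableSet[m'] D' ∧ s ∩ A = D' ∩ A) {D : Set α}
    (hD : MeasurableSet[MeasurableSpace.generateFrom P] D) :
    ∃ D', MeasurableSet[m'] D' ∧ D ∩ A = D' ∩ A := by
  induction hD with
  | basic s hs => exact h s hs
  | empty => exact ⟨∅, MeasurableSet.empty, rfl⟩
  | compl s _ ih =>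
    obtain ⟨D', hD', heq⟩ := ih
    refine ⟨D'ᶜ, hD'.compl, ?_⟩
    ext x
    have := Set.ext_iff.mp heq x
    simp only [Set.mem_inter_iff, Set.mem_compl_iff] at this ⊢
    tauto
  | iUnion g _ ih =>
    choose D' hD' heq using ih
    exact ⟨⋃ i, D' i, MeasurableSet.iUnion hD', by simp only [Set.iUnion_inter, heq]⟩

end CondExp

/-! ### Relative independence of edges of equal size -/

namespace Ultra

variable {J : Type u} {V : ℕ → J → Type v}

/-- The ultraproduct of the product spaces `∏ j, V n j`. -/
abbrev ProdUltra (V : ℕ → J → Type v) := Ultra fun n => ∀ j, V n j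

/-- The subsets of `e` with fewer than `j` elements. -/
def low (j : ℕ) (e : Finset J) : Set (Finset J) := {e' | e' ⊆ e ∧ e'.card < j}

theorem sig_low_le_singleton (j : ℕ) (e : Finset J) : sig V (low j e) ≤ sig V {e} :=
  sig_mono fun _ he' => ⟨e, rfl, he'.1⟩

variable [DecidableEq J] [Fintype J] [∀ n j, Fintype (V n j)] [∀ n j, Nonempty (V n j)]

/-- The Loeb measure on the ultraproduct of the product spaces `∏ j, V n j`. -/
noncomputable abbrev prodLoeb (V : ℕ → J → Type v) [∀ n j, Fintype (V n j)]
    [∀ n j, Nonempty (V n j)] : Measure (ProdUltra V) :=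
  loeb fun n => ∀ j, V n j

/-- Conditioning on `𝓒` and the traces determines the integral over the sets measurable with
respect to `𝓒` and the σ-algebra of `𝓢`. -/
theorem setIntegral_condExp_of_traces {e : Finset J} {𝓢 : Set (Finset J)} {j : ℕ}
    (h𝓢 : ∀ e' ∈ 𝓢, (e' ∩ e).card < j) {𝓒 : MeasurableSpace (ProdUltra V)} (h𝓒 : 𝓒 ≤ sig V {e})
    {E R : Set (ProdUltra V)} (hE : MeasurableSet[sig V {e}] E)
    (hR : MeasurableSet[𝓒 ⊔ sig V 𝓢] R) :
    ∫ x in R, ((prodLoeb V)[E.indicator fun _ => (1 : ℝ) | 𝓒 ⊔ sig V (low j e)]) x ∂(prodLoeb V) =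
      (prodLoeb V).real (R ∩ E) := by
  have hE0 := sig_le _ _ hE
  have hm1 : 𝓒 ⊔ sig V (low j e) ≤ sig V {e} := sup_le h𝓒 (sig_low_le_singleton j e)
  have hm := hm1.trans (sig_le _)
  have hR0 := (sup_le (h𝓒.trans (sig_le {e})) (sig_le 𝓢)) _ hR
  have hint := integrable_indicator_one (μ := prodLoeb V) hE0
  have hcint : Integrable ((prodLoeb V)[E.indicator fun _ => (1 : ℝ) | 𝓒 ⊔ sig V (low j e)])
    (prodLoeb V) := integrable_condExp
  -- Traces of `𝓢` on `e` are subsets of `e` of size less than `j`, so the indicator minus its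
  -- conditional expectation is orthogonal to them jointly with `𝓒`.
  have key := setIntegral_eq_zero_of_sup_traces h𝓒 (𝓢 := 𝓢) (hint.sub hcint)
    (((@stronglyMeasurable_const _ _ (sig V {e}) _ (1 : ℝ)).indicator hE).sub
      (stronglyMeasurable_condExp.mono hm1)) (fun D hD => ?_) hR
  · simp only [Pi.sub_apply] at key
    rw [integral_sub hint.integrableOn hcint.integrableOn, setIntegral_indicator hE0,
      setIntegral_const, smul_eq_mul, mul_one] at key
    linarith
  · have hD' : MeasurableSet[𝓒 ⊔ sig V (low j e)] D := by
      refine sup_le_sup_left (sig_mono ?_) 𝓒 D hD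
      rintro _ ⟨e', he', rfl⟩
      exact ⟨_, ⟨Finset.inter_subset_right, h𝓢 e' he'⟩, subset_rfl⟩
    simp only [Pi.sub_apply]
    rw [integral_sub hint.integrableOn hcint.integrableOn, setIntegral_indicator hE0,
      setIntegral_condExp_indicator hm hE0 hD', setIntegral_const, smul_eq_mul, mul_one, sub_self]

/-- Over `R` the conditional probability of `E` integrates to the measure of `E ∩ R`, which is zero;
being non-negative, it vanishes almost everywhere on `R`. -/
theorem measure_condPos_inter_of_traces {e : Finset J} {𝓢 : Set (Finset J)} {j : ℕ}
    (h𝓢 : ∀ e' ∈ 𝓢, (e' ∩ e).card < j) {E R : Set (ProdUltra V)} (hE : MeasurableSet[sig V {e}] E)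
    (hR : MeasurableSet[sig V 𝓢] R) (h : prodLoeb V (E ∩ R) = 0) :
    prodLoeb V (condPos (prodLoeb V) (sig V (low j e)) E ∩ R) = 0 := by
  refine measure_condPos_inter_eq_zero (sig_le _ _ hR) ?_
  have := setIntegral_condExp_of_traces h𝓢 (𝓒 := ⊥) bot_le hE (R := R) (by rwa [bot_sup_eq])
  rw [bot_sup_eq] at this
  rw [this, Set.inter_comm, Measure.real, h, ENNReal.toReal_zero]

/-- Relative independence: in a null intersection, sets depending on different edges of size `j`
may be replaced by the sets on which they have positive probability relative to lower edges. -/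
theorem measure_iInter_condPos_inter_eq_zero {β : Type*} [Fintype β] [DecidableEq β] {j : ℕ}
    {e : β → Finset J} (he : Function.Injective e) (hcard : ∀ b, (e b).card = j)
    {E : β → Set (ProdUltra V)} (hE : ∀ b, MeasurableSet[sig V {e b}] (E b))
    {G : Set (ProdUltra V)} (hG : MeasurableSet[sig V {e' | e'.card < j}] G)
    (h : prodLoeb V ((⋂ b, E b) ∩ G) = 0) :
    prodLoeb V ((⋂ b, condPos (prodLoeb V) (sig V (low j (e b))) (E b)) ∩ G) = 0 := by
  let P : β → Set (ProdUltra V) := fun b => condPos (prodLoeb V) (sig V (low j (e b))) (E b)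
  have hP : ∀ b, MeasurableSet[sig V (low j (e b))] (P b) := fun b => measurableSet_condPos _
  -- The sets are replaced one at a time. All the others, replaced or not, meet the current edge in
  -- fewer than `j` vertices, because distinct `j`-sets do.
  have key : ∀ s : Finset β, prodLoeb V ((⋂ b, if b ∈ s then P b else E b) ∩ G) = 0 := by
    intro s
    induction s using Finset.induction_on with
    | empty => simpa using h
    | insert b₀ s hb₀ ih =>
      let R : Set (ProdUltra V) := (⋂ b : {b // b ≠ b₀}, if b.1 ∈ s then P b else E b) ∩ G
      let 𝓢 : Set (Finset J) := {e' | e'.card < j ∨ ∃ b ≠ b₀, e b = e'}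
      have hR : MeasurableSet[sig V 𝓢] R := by
        refine MeasurableSet.inter (MeasurableSet.iInter fun b => ?_)
          (sig_mono (fun e' he' => ⟨e', Or.inl he', subset_rfl⟩) _ hG)
        split_ifs
        · exact sig_mono (fun e' he' => ⟨e', Or.inl he'.2, subset_rfl⟩) _ (hP b)
        · exact sig_mono (fun e' he' => ⟨e', Or.inr ⟨b.1, b.2, he'.symm⟩, subset_rfl⟩) _ (hE b)
      have h𝓢 : ∀ e' ∈ 𝓢, (e' ∩ e b₀).card < j := by
        rintro e' (he' | ⟨b, hb, rfl⟩)
        · exact (Finset.card_le_card Finset.inter_subset_left).trans_lt he'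
        · refine lt_of_le_of_ne ((Finset.card_le_card Finset.inter_subset_left).trans_eq
            (hcard b)) fun hcon => hb (he ?_)
          have h1 : e b ∩ e b₀ = e b :=
            Finset.eq_of_subset_of_card_le Finset.inter_subset_left (by rw [hcon, hcard])
          exact Finset.eq_of_subset_of_card_le (Finset.inter_eq_left.mp h1)
            (by rw [hcard, hcard])
      refine measure_mono_null ?_ (measure_condPos_inter_of_traces h𝓢 (hE b₀) hR
        (measure_mono_null ?_ ih))
      · intro x hx
        refine ⟨by simpa using Set.mem_iInter.mp hx.1 b₀, Set.mem_iInter.mpr fun b => ?_, hx.2⟩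
        simpa [b.2] using Set.mem_iInter.mp hx.1 b.1
      · intro x hx
        refine ⟨Set.mem_iInter.mpr fun b => ?_, hx.2.2⟩
        by_cases hb : b = b₀
        · subst hb
          simpa [hb₀] using hx.1
        · exact Set.mem_iInter.mp hx.2.1 ⟨b, hb⟩
  simpa using key Finset.univ

end Ultra

/-! ### Atoms and the infinitary removal lemma -/

namespace Ultra

section General

variable {X : ℕ → Type*} {𝒢 ℋ : Set (Set (Σ n, X n))} {F : Set (Σ n, X n)}

theorem sigOf_union (𝒢 ℋ : Set (Set (Σ n, X n))) : sigOf (𝒢 ∪ ℋ) = sigOf 𝒢 ⊔ sigOf ℋ := by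
  rw [sigOf, sigOf, sigOf, Set.image_union, MeasurableSpace.generateFrom_sup_generateFrom]

theorem FinGen.trans_of_finite {𝒯 : Set (Set (Σ n, X n))} (h𝒯 : 𝒯.Finite) (hF : FinGen 𝒯 F)
    (h : ∀ T ∈ 𝒯, FinGen 𝒢 T) : FinGen 𝒢 F := by
  obtain ⟨𝒯', -, h2, h3⟩ := hF
  have := h𝒯.to_subtype
  choose 𝒰 g1 g2 g3 using fun T : 𝒯 => h T.1 T.2
  refine ⟨⋃ T, 𝒰 T, Set.finite_iUnion g1, Set.iUnion_subset g2, fun n x y hxy => h3 n x y ?_⟩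
  exact fun T hT => g3 ⟨T, h2 hT⟩ n x y fun U hU => hxy U (Set.mem_iUnion.mpr ⟨⟨T, h2 hT⟩, hU⟩)

end General

variable {J : Type u} {V : ℕ → J → Type v}

/-- The points whose membership in the sets of `𝒯` depending only on the coordinates in `e` is
prescribed by `κ`. -/
def atom (𝒯 : Set (Set (Σ n, ∀ j, V n j))) (e : Finset J) (κ : 𝒯 → Prop) :
    Set (Σ n, ∀ j, V n j) :=
  {p | ∀ T : 𝒯, IsLocal e T.1 → (p ∈ T.1 ↔ κ T)}

theorem isLocal_atom (𝒯 : Set (Set (Σ n, ∀ j, V n j))) (e : Finset J) (κ : 𝒯 → Prop) :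
    IsLocal e (atom 𝒯 e κ) := by
  intro n x y hxy
  exact forall_congr' fun T => forall_congr' fun hT => by rw [hT n x y hxy]

theorem atom_eq_or_disjoint (𝒯 : Set (Set (Σ n, ∀ j, V n j))) (e : Finset J) (κ κ' : 𝒯 → Prop) :
    atom 𝒯 e κ = atom 𝒯 e κ' ∨ atom 𝒯 e κ ∩ atom 𝒯 e κ' = ∅ := by
  rcases Set.eq_empty_or_nonempty (atom 𝒯 e κ ∩ atom 𝒯 e κ') with h | ⟨p, hp, hp'⟩
  · exact Or.inr h
  · left
    ext q
    refine forall_congr' fun T => forall_congr' fun hT => ?_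
    rw [← hp T hT, ← hp' T hT]

/-- The atoms of the edges of size `j` contained in `e`. -/
def atoms (𝒯 : Set (Set (Σ n, ∀ j, V n j))) (j : ℕ) (e : Finset J) :
    Set (Set (Σ n, ∀ j, V n j)) :=
  {A | ∃ e' ⊆ e, e'.card = j ∧ ∃ κ, A = atom 𝒯 e' κ}

/-- A set on a `j`-edge is a union of atoms of that edge; a set on a smaller edge is already among
the lower-order generators. -/
theorem finGen_atoms_of_finGen {𝒯 𝒰 : Set (Set (Σ n, ∀ j, V n j))} (h𝒯 : 𝒯.Finite) (h𝒰 : 𝒰 ⊆ 𝒯)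
    {j : ℕ} {e : Finset J} (hle : 𝒰 ⊆ loc V (low (j + 1) e)) {F : Set (Σ n, ∀ j, V n j)}
    (hF : FinGen 𝒰 F) : FinGen (atoms 𝒯 j e ∪ loc V (low j e)) F := by
  have := h𝒯.to_subtype
  refine hF.trans_of_finite (h𝒯.subset h𝒰) fun T hT => ?_
  obtain ⟨e', ⟨he', hcard⟩, hloc⟩ := hle hT
  rcases Nat.lt_succ_iff_lt_or_eq.mp hcard with hlt | heq
  · exact FinGen.of_mem (Or.inr ⟨e', ⟨he', hlt⟩, hloc⟩)
  · refine ⟨Set.range (atom 𝒯 e'), Set.finite_range _, ?_, fun n x y hxy => ?_⟩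
    · rintro _ ⟨κ, rfl⟩
      exact Or.inl ⟨e', he', heq, κ, rfl⟩
    · have h1 := hxy _ ⟨fun T : 𝒯 => (⟨n, x⟩ : Σ n, ∀ j, V n j) ∈ T.1, rfl⟩
      exact (h1.mp (fun T _ => Iff.rfl) ⟨T, h𝒰 hT⟩ hloc).symm

/-- Inside a fixed tuple of atoms every top-level generator is everything or nothing, so only
lower-order information remains. -/
theorem exists_inter_lift_eq {𝒯 : Set (Set (Σ n, ∀ j, V n j))} {j : ℕ} {e : Finset J}
    {A : Set (ProdUltra V)}
    (hA : ∀ e' ⊆ e, e'.card = j → ∃ κ, A ⊆ lift (atom 𝒯 e' κ)) {D : Set (ProdUltra V)}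
    (hD : MeasurableSet[sigOf (atoms 𝒯 j e ∪ loc V (low j e))] D) :
    ∃ D', MeasurableSet[sig V (low j e)] D' ∧ D ∩ A = D' ∩ A := by
  refine exists_inter_eq_of_generateFrom ?_ hD
  rintro _ ⟨_, ⟨e', he', hcard, κ, rfl⟩ | hT, rfl⟩
  · obtain ⟨κ', hκ'⟩ := hA e' he' hcard
    rcases atom_eq_or_disjoint 𝒯 e' κ κ' with h | h
    · refine ⟨Set.univ, @MeasurableSet.univ _ (sig V (low j e)), ?_⟩
      rw [Set.univ_inter, h, Set.inter_eq_right]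
      exact hκ'
    · refine ⟨∅, @MeasurableSet.empty _ (sig V (low j e)), ?_⟩
      rw [Set.empty_inter]
      refine Set.subset_empty_iff.mp (fun x hx => ?_)
      have : x ∈ lift (atom 𝒯 e' κ ∩ atom 𝒯 e' κ') := by
        rw [lift_inter]
        exact ⟨hx.1, hκ' hx.2⟩
      rwa [h, lift_empty] at this
  · exact ⟨_, MeasurableSpace.measurableSet_generateFrom ⟨_, hT, rfl⟩, rfl⟩

theorem sigOf_atoms_le (𝒯 : Set (Set (Σ n, ∀ j, V n j))) (j : ℕ) (e : Finset J) :
    sigOf (atoms 𝒯 j e) ≤ sig V {e} := by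
  refine sigOf_mono ?_
  rintro _ ⟨e', he', -, κ, rfl⟩
  exact ⟨e, rfl, (isLocal_atom 𝒯 e' κ).mono he'⟩

variable [DecidableEq J] [Fintype J] [∀ n j, Fintype (V n j)] [∀ n j, Nonempty (V n j)]

/-- Sets measurable with respect to edges of size at most `j` are, up to a small error, contained
in sets which use only finitely many internal sets of the top level; this preserves nullity of the
intersection. -/
theorem exists_atoms_measurable_of_null {ι : Type*} [Fintype ι] {j : ℕ} {e : ι → Finset J}
    {E : ι → Set (ProdUltra V)} (hE : ∀ i, MeasurableSet[sig V (low (j + 1) (e i))] (E i))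
    (h : prodLoeb V (⋂ i, E i) = 0) {ε : ℝ} (hε : 0 < ε) :
    ∃ (𝒯 : Set (Set (Σ n, ∀ j, V n j))) (G : ι → Set (ProdUltra V)), 𝒯.Finite ∧
      (∀ i, MeasurableSet[sigOf (atoms 𝒯 j (e i) ∪ loc V (low j (e i)))] (G i)) ∧
      prodLoeb V (⋂ i, G i) = 0 ∧ ∀ i, (prodLoeb V).real (E i \ G i) ≤ ε := by
  set k : ℝ := (Fintype.card ι : ℝ) with hk
  have hk0 : 0 ≤ k := Nat.cast_nonneg _
  -- With threshold t = 1/(k+1), an approximation error η costs η/t + η = (k+2)η.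
  choose Q hQ hQE using fun i => exists_finGen_approx (hE i) (ε := ε / (k + 2)) (by positivity)
  choose 𝒰 h𝒰fin h𝒰 hQ𝒰 using hQ
  let 𝒯 : Set (Set (Σ n, ∀ j, V n j)) := ⋃ i, 𝒰 i
  have h𝒯 : 𝒯.Finite := Set.finite_iUnion h𝒰fin
  let m : ι → MeasurableSpace (ProdUltra V) := fun i =>
    sigOf (atoms 𝒯 j (e i)) ⊔ sig V (low j (e i))
  have hm : ∀ i, m i = sigOf (atoms 𝒯 j (e i) ∪ loc V (low j (e i))) :=
    fun i => (sigOf_union _ _).symm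
  have hm0 : ∀ i, m i ≤ instMeasurableSpace := fun i => sup_le (sigOf_le _) (sig_le _)
  have hQm : ∀ i, MeasurableSet[m i] (lift (Q i)) := by
    intro i
    rw [hm]
    exact (finGen_atoms_of_finGen h𝒯 (Set.subset_iUnion 𝒰 i) (h𝒰 i)
      ⟨𝒰 i, h𝒰fin i, subset_rfl, hQ𝒰 i⟩).measurableSet_lift
  have hEe : ∀ i, MeasurableSet[sig V {e i}] (E i) := fun i => sig_low_le_singleton _ _ _ (hE i)
  have hE0 : ∀ i, MeasurableSet (E i) := fun i => sig_le _ _ (hE i)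
  let q : ι → ProdUltra V → ℝ := fun i => (prodLoeb V)[(E i)ᶜ.indicator fun _ => (1 : ℝ) | m i]
  -- With this threshold the `k` complements together take at most the fraction k/(k+1) of `⋂ i, G
  -- i`, so `⋂ i, E i` would get the rest.
  let G : ι → Set (ProdUltra V) := fun i => {x | q i x < 1 / (k + 1)}
  have hG : ∀ i, MeasurableSet[m i] (G i) := fun i =>
    @measurableSet_lt _ _ _ _ _ (m i) _ _ _ _ _ stronglyMeasurable_condExp.measurable
      (@measurable_const _ _ _ (m i) _)
  refine ⟨𝒯, G, h𝒯, fun i => hm i ▸ hG i, ?_, fun i => ?_⟩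
  · refine measure_eq_zero_of_small_diff h fun i => ?_
    -- Atoms on `j`-edges not contained in `e i` are handled like lower-order sets, since their
    -- traces on `e i` are smaller than `j`. Only the atoms inside `e i` must be conditioned on.
    let 𝓢 : Set (Finset J) := {e' | e'.card < j ∨ e'.card = j ∧ ¬ e' ⊆ e i}
    have h𝓢 : ∀ e' ∈ 𝓢, (e' ∩ e i).card < j := by
      rintro e' (he' | ⟨he', hnot⟩)
      · exact (Finset.card_le_card Finset.inter_subset_left).trans_lt he'
      · rw [← he']
        refine Finset.card_lt_card ⟨Finset.inter_subset_left, fun hcon => hnot ?_⟩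
        exact hcon.trans Finset.inter_subset_right
    have hle : ∀ i', m i' ≤ sigOf (atoms 𝒯 j (e i)) ⊔ sig V 𝓢 := by
      intro i'
      rw [hm, ← sigOf_union]
      refine sigOf_mono ?_
      rintro _ (⟨e', he', hcard, κ, rfl⟩ | ⟨e', he', hT⟩)
      · by_cases hsub : e' ⊆ e i
        · exact Or.inl ⟨e', hsub, hcard, κ, rfl⟩
        · exact Or.inr ⟨e', Or.inr ⟨hcard, hsub⟩, isLocal_atom _ _ _⟩
      · exact Or.inr ⟨e', Or.inl he'.2, hT⟩
    have hN : MeasurableSet[sigOf (atoms 𝒯 j (e i)) ⊔ sig V 𝓢] (⋂ i, G i) :=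
      MeasurableSet.iInter fun i' => hle i' _ (hG i')
    have hN0 : MeasurableSet (⋂ i, G i) := MeasurableSet.iInter fun i' => hm0 i' _ (hG i')
    rw [← setIntegral_condExp_of_traces h𝓢 (sigOf_atoms_le 𝒯 j (e i)) (hEe i).compl hN]
    calc ∫ x in ⋂ i, G i, q i x ∂(prodLoeb V) ≤ ∫ x in ⋂ i, G i, 1 / (k + 1) ∂(prodLoeb V) :=
          setIntegral_mono_on integrable_condExp.integrableOn (integrable_const _).integrableOn hN0
            fun x hx => (Set.mem_iInter.mp hx i).le
      _ = 1 / (k + 1) * (prodLoeb V).real (⋂ i, G i) := by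
          rw [setIntegral_const, smul_eq_mul, mul_comm]
  · refine (measureReal_diff_condExp_lt_le (hm0 i) (hE0 i) (hQm i) (t := 1 / (k + 1))
      (by positivity) (hQE i).le).trans_eq ?_
    field_simp
    ring

/-- The infinitary removal lemma: a finite family of sets with null intersection, each generated
by edges of size less than `j`, can be approximated from outside by Boolean combinations of
internal sets with empty intersection. -/
theorem exists_finGen_iInter_eq_empty (j : ℕ) : ∀ {ι : Type u} [Fintype ι] (e : ι → Finset J)
    (E : ι → Set (ProdUltra V)), (∀ i, MeasurableSet[sig V (low j (e i))] (E i)) →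
    prodLoeb V (⋂ i, E i) = 0 → ∀ {ε : ℝ}, 0 < ε →
    ∃ F : ι → Set (Σ n, ∀ j, V n j), (∀ i, FinGen (loc V (low j (e i))) (F i)) ∧
      (⋂ i, F i) = ∅ ∧ ∀ i, (prodLoeb V).real (E i \ lift (F i)) ≤ ε := by
  classical
  induction j with
  | zero =>
    intro ι _ e E hE h ε hε
    have htriv : ∀ i, E i = ∅ ∨ E i = Set.univ := by
      intro i
      have hloc : loc V (low 0 (e i)) = ∅ := by
        ext T
        simp [loc, low]
      have hbot : sig V (low 0 (e i)) = ⊥ := by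
        rw [sig, sigOf, hloc, Set.image_empty, MeasurableSpace.generateFrom_empty]
      have := hE i
      rw [hbot] at this
      exact MeasurableSpace.measurableSet_bot_iff.mp this
    -- Otherwise the intersection is the whole space, which has measure one; this also excludes an
    -- empty index type.
    obtain ⟨i₀, hi₀⟩ : ∃ i, E i = ∅ := by
      by_contra! hcon
      have : ∀ i, E i = Set.univ := fun i =>
        (htriv i).resolve_left (Set.nonempty_iff_ne_empty.mp (hcon i))
      simp [this] at h
    refine ⟨fun i => if E i = ∅ then ∅ else Set.univ, fun i => ?_, ?_, fun i => ?_⟩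
    · dsimp only
      split_ifs
      · exact FinGen.empty
      · exact FinGen.univ
    · refine Set.subset_empty_iff.mp fun p hp => ?_
      simpa [hi₀] using Set.mem_iInter.mp hp i₀
    · rcases htriv i with hi | hi
      · simp [hi, hε.le]
      · by_cases hi' : E i = ∅
        · simp [hi', hε.le]
        · simp [hi', hε.le]
  | succ j ih =>
    intro ι _ e E hE h ε hε
    obtain ⟨𝒯, G, h𝒯, hG, hGnull, hEG⟩ := exists_atoms_measurable_of_null hE h (half_pos hε)
    have := h𝒯.to_subtype
    -- Only `j`-sets below some `e i` are kept, so that each cover of a positivity locus enters at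
    -- least one `F' i`.
    let β : Type u := {e' : Finset J // e'.card = j ∧ ∃ i, e' ⊆ e i}
    let K := β → 𝒯 → Prop
    have := Fintype.ofFinite K
    have hK0 : (0 : ℝ) < Fintype.card K := Nat.cast_pos.mpr Fintype.card_pos
    let A : K → β → Set (Σ n, ∀ j, V n j) := fun κ b => atom 𝒯 b.1 (κ b)
    have hA : ∀ κ b, IsLocal b.1 (A κ b) := fun κ b => isLocal_atom _ _ _
    -- The part of `G i` in a given tuple of atoms.
    have hdec : ∀ (κ : K) (i : ι), ∃ D', MeasurableSet[sig V (low j (e i))] D' ∧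
        G i ∩ (⋂ b : {b : β // b.1 ⊆ e i}, lift (A κ b.1)) =
          D' ∩ ⋂ b : {b : β // b.1 ⊆ e i}, lift (A κ b.1) := fun κ i =>
      exists_inter_lift_eq (fun e' he' hcard => ⟨κ ⟨e', hcard, i, he'⟩,
        Set.iInter_subset_of_subset ⟨⟨e', hcard, i, he'⟩, he'⟩ subset_rfl⟩) (hG i)
    choose D hD hGD using hdec
    let P : K → β → Set (ProdUltra V) := fun κ b =>
      condPos (prodLoeb V) (sig V (low j b.1)) (lift (A κ b))
    have hAP : ∀ κ b, (prodLoeb V).real (lift (A κ b) \ P κ b) = 0 := fun κ b =>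
      measureReal_diff_condPos (sig_le _) (measurableSet_lift _)
    have hnull : ∀ κ : K, prodLoeb V (⋂ x : ι ⊕ β, Sum.elim (D κ) (P κ) x) = 0 := by
      intro κ
      have h1 : prodLoeb V ((⋂ b, lift (A κ b)) ∩ ⋂ i, D κ i) = 0 := by
        refine measure_mono_null (fun x hx => Set.mem_iInter.mpr fun i => ?_) hGnull
        have hx' : x ∈ D κ i ∩ ⋂ b : {b : β // b.1 ⊆ e i}, lift (A κ b.1) :=
          ⟨Set.mem_iInter.mp hx.2 i, Set.mem_iInter.mpr fun b => Set.mem_iInter.mp hx.1 b.1⟩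
        rw [← hGD] at hx'
        exact hx'.1
      have h2 := measure_iInter_condPos_inter_eq_zero (V := V) (e := fun b : β => b.1)
        Subtype.val_injective (fun b => b.2.1)
        (fun b => (hA κ b).measurableSet_lift (Set.mem_singleton b.1))
        (MeasurableSet.iInter fun i =>
          sig_mono (fun e' he' => ⟨e', he'.2, subset_rfl⟩) _ (hD κ i)) h1
      rwa [Set.iInter_sum, Set.inter_comm]
    -- Half of ε pays for passing from `E i` to `G i`; the other half is shared among the tuples,
    -- each with one error from `D` and one for every `b`.
    let C : ℝ := 2 * Fintype.card K * (1 + Fintype.card β)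
    have hC : 0 < C := by positivity
    have hF := fun κ : K => ih (ι := ι ⊕ β) (Sum.elim e fun b => b.1) (Sum.elim (D κ) (P κ))
      (by
        rintro (i | b)
        · exact hD κ i
        · exact measurableSet_condPos _) (hnull κ) (div_pos hε hC)
    choose F hFgen hFempty hFsmall using hF
    -- Each condition binds only inside its own tuple of atoms, where it imposes the covers supplied
    -- by induction.
    let F' : ι → Set (Σ n, ∀ j, V n j) := fun i => ⋂ κ : K,
      (⋂ b : {b : β // b.1 ⊆ e i}, A κ b.1)ᶜ ∪
        (F κ (Sum.inl i) ∩ ⋂ b : {b : β // b.1 ⊆ e i}, F κ (Sum.inr b.1))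
    refine ⟨F', fun i => ?_, ?_, fun i => ?_⟩
    · refine FinGen.iInter fun κ => FinGen.union (FinGen.iInter fun b => FinGen.of_mem ?_).compl
        (FinGen.inter ((hFgen κ (Sum.inl i)).mono (loc_mono ?_)) (FinGen.iInter fun b =>
          (hFgen κ (Sum.inr b.1)).mono (loc_mono ?_)))
      · exact ⟨b.1.1, ⟨b.2, by rw [b.1.2.1]; exact Nat.lt_succ_self j⟩, hA κ b.1⟩
      · exact fun e' he' => ⟨e', ⟨he'.1, he'.2.trans (Nat.lt_succ_self j)⟩, subset_rfl⟩
      · exact fun e' he' =>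
          ⟨e', ⟨he'.1.trans b.2, he'.2.trans (Nat.lt_succ_self j)⟩, subset_rfl⟩
    · refine Set.subset_empty_iff.mp fun p hp => ?_
      -- The tuple of atoms containing `p` itself activates the conditions of this `κ`, which place
      -- `p` in an empty intersection.
      let κ : K := fun _ T => p ∈ T.1
      have hpA : ∀ b, p ∈ A κ b := fun b T _ => Iff.rfl
      have hp' : ∀ i, p ∈ F κ (Sum.inl i) ∩ ⋂ b : {b : β // b.1 ⊆ e i}, F κ (Sum.inr b.1) := by
        intro i
        refine (Set.mem_iInter.mp (Set.mem_iInter.mp hp i) κ).resolve_left fun hcon => hcon ?_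
        exact Set.mem_iInter.mpr fun b => hpA b.1
      rw [← hFempty κ]
      refine Set.mem_iInter.mpr ?_
      rintro (i | b)
      · exact (hp' i).1
      · obtain ⟨i, hi⟩ := b.2.2
        exact Set.mem_iInter.mp (hp' i).2 ⟨b, hi⟩
    -- The exceptional set of a tuple: the errors of the inductive covers, together with the null
    -- parts of atoms off their positivity loci.
    · let R : K → Set (ProdUltra V) := fun κ => (D κ i \ lift (F κ (Sum.inl i))) ∪
        ⋃ b : β, (lift (A κ b) \ P κ b) ∪ (P κ b \ lift (F κ (Sum.inr b)))
      have hR : ∀ κ, (prodLoeb V).real (R κ) ≤ ε / C * (1 + Fintype.card β) := by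
        intro κ
        calc (prodLoeb V).real (R κ) ≤ (prodLoeb V).real (D κ i \ lift (F κ (Sum.inl i))) +
              ∑ b : β, (prodLoeb V).real
                ((lift (A κ b) \ P κ b) ∪ (P κ b \ lift (F κ (Sum.inr b)))) :=
              (measureReal_union_le _ _).trans (by gcongr; exact measureReal_iUnion_fintype_le _)
          _ ≤ ε / C + ∑ b : β, ε / C := by
              gcongr with b
              · exact hFsmall κ (Sum.inl i)
              · refine (measureReal_union_le _ _).trans ?_
                rw [hAP, zero_add]
                exact hFsmall κ (Sum.inr b)
          _ = ε / C * (1 + Fintype.card β) := by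
              rw [Finset.sum_const, Finset.card_univ, nsmul_eq_mul]
              ring
      have hsub : E i \ lift (F' i) ⊆ (E i \ G i) ∪ ⋃ κ, R κ := by
        rintro x ⟨hxE, hxF⟩
        by_cases hxG : x ∈ G i
        · right
          simp only [F', lift_union, lift_compl, lift_inter, lift_iInter, Set.mem_iInter,
            not_forall] at hxF
          obtain ⟨κ, hκ⟩ := hxF
          rw [Set.mem_union, not_or, Set.mem_compl_iff, not_not] at hκ
          refine Set.mem_iUnion.mpr ⟨κ, ?_⟩
          have hxD : x ∈ D κ i := by
            have : x ∈ G i ∩ ⋂ b : {b : β // b.1 ⊆ e i}, lift (A κ b.1) := ⟨hxG, hκ.1⟩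
            rw [hGD] at this
            exact this.1
          by_cases hx1 : x ∈ lift (F κ (Sum.inl i))
          · right
            have hx2 : ¬ ∀ b : {b : β // b.1 ⊆ e i}, x ∈ lift (F κ (Sum.inr b.1)) :=
              fun hcon => hκ.2 ⟨hx1, Set.mem_iInter.mpr hcon⟩
            push Not at hx2
            obtain ⟨b, hb⟩ := hx2
            refine Set.mem_iUnion.mpr ⟨b.1, ?_⟩
            by_cases hxP : x ∈ P κ b.1
            · exact Or.inr ⟨hxP, hb⟩
            · exact Or.inl ⟨Set.mem_iInter.mp hκ.1 b, hxP⟩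
          · exact Or.inl ⟨hxD, hx1⟩
        · exact Or.inl ⟨hxE, hxG⟩
      calc (prodLoeb V).real (E i \ lift (F' i)) ≤
            (prodLoeb V).real (E i \ G i) + ∑ κ, (prodLoeb V).real (R κ) :=
            (measureReal_mono hsub).trans ((measureReal_union_le _ _).trans
              (by gcongr; exact measureReal_iUnion_fintype_le _))
        _ ≤ ε / 2 + ∑ _κ : K, ε / C * (1 + Fintype.card β) := by
            gcongr with κ
            · exact hEG i
            · exact hR κ
        _ = ε := by
            rw [Finset.sum_const, Finset.card_univ, nsmul_eq_mul]
            have hb : (0 : ℝ) < 1 + Fintype.card β := by positivity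
            simp only [C]
            field_simp
            ring

end Ultra

/-! ### Complexity and the return to finite systems -/

theorem sigmaComplexity_generateFrom_le {X : Type*} (G : Set (Set X)) :
    sigmaComplexity (MeasurableSpace.generateFrom G) ≤ G.encard :=
  iInf₂_le (f := fun (G' : Set (Set X)) (_ : MeasurableSpace.generateFrom G' =
    MeasurableSpace.generateFrom G) => G'.encard) G rfl

namespace HypergraphSystem

variable {J : Type u}

theorem measurableSet_sigmaAlg_iff (S : HypergraphSystem.{u, v} J) (e : Finset J)
    (X : Set S.Total) : MeasurableSet[S.sigmaAlg e] X ↔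
      ∀ x y : S.Total, (∀ j ∈ e, x j = y j) → (x ∈ X ↔ y ∈ X) := by
  constructor
  · rintro ⟨Y, -, rfl⟩ x y hxy
    have : S.proj e x = S.proj e y := funext fun j => hxy j j.2
    simp only [Set.mem_preimage, this]
  · intro h
    refine ⟨S.proj e '' X, trivial, ?_⟩
    ext x
    refine ⟨?_, fun hx => ⟨x, hx, rfl⟩⟩
    rintro ⟨y, hy, hyx⟩
    exact (h y x fun j hj => congrFun hyx ⟨j, hj⟩).mp hy

variable [Fintype J] [DecidableEq J]

theorem expectation_eq_avg (S : HypergraphSystem.{u, v} J) (f : S.Total → ℝ) :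
    S.expectation f = avg f := rfl

/-- The sets `E e` can be covered up to errors `ε` by sets with empty intersection, which are
generated by lower order σ-algebras of complexity at most `N`. -/
def Removable (S : HypergraphSystem.{u, v} J) (E : Finset J → Set S.Total) (ε : ℝ) (N : ℕ) : Prop :=
  ∃ (E' : Finset J → Set S.Total) (B : Finset J → MeasurableSpace S.Total),
    (∀ e ∈ S.H, MeasurableSet[S.sigmaAlg e] (E' e)) ∧
    (⋂ e ∈ S.H, E' e) = ∅ ∧
    (∀ e ∈ S.H, S.expectation (indicatorFn (E e \ E' e)) ≤ ε) ∧
    (∀ e' : Finset J, e'.card < S.d →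
      B e' ≤ S.sigmaAlg e' ∧ sigmaComplexity (B e') ≤ (N : ℕ∞)) ∧
    (∀ e ∈ S.H, MeasurableSet[⨆ (e' : Finset J) (_ : e' ⊂ e), B e'] (E' e))

theorem edges_nonempty_of_expectation_lt_one {S : HypergraphSystem.{u, v} J}
    {E : Finset J → Set S.Total}
    (h : S.expectation (fun x => ∏ e ∈ S.H, indicatorFn (E e) x) < 1) : S.H.Nonempty := by
  by_contra hH
  rw [Finset.not_nonempty_iff_eq_empty] at hH
  simp only [hH, Finset.prod_empty, expectation_eq_avg, avg_const] at h
  exact lt_irrefl _ h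

/-- Empty sets serve when the permitted error is 1; this covers the values of δ that are not small.
-/
theorem removable_one {S : HypergraphSystem.{u, v} J} {E : Finset J → Set S.Total}
    (hH : S.H.Nonempty) (N : ℕ) : S.Removable E 1 N := by
  obtain ⟨e₀, he₀⟩ := hH
  refine ⟨fun _ => ∅, fun _ => ⊥, fun e _ => MeasurableSpace.measurableSet_empty _, ?_, fun e _ => ?_,
    fun e' _ => ⟨bot_le, ?_⟩, fun e _ => MeasurableSpace.measurableSet_empty _⟩
  · exact Set.subset_empty_iff.mp fun x hx => Set.mem_iInter₂.mp hx e₀ he₀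
  · rw [expectation_eq_avg, ← avg_const (X := S.Total) (1 : ℝ)]
    exact avg_mono fun x => Set.indicator_le_self' (fun _ _ => zero_le_one) x
  · rw [← MeasurableSpace.generateFrom_empty]
    exact (sigmaComplexity_generateFrom_le ∅).trans (by simp)

open Ultra in
theorem exists_removable_of_sequence (S : ℕ → HypergraphSystem.{u, v} J)
    (E : ∀ n, Finset J → Set (S n).Total)
    (hE : ∀ n, ∀ e ∈ (S n).H, MeasurableSet[(S n).sigmaAlg e] (E n e))
    (hexp : ∀ n, (S n).expectation (fun x => ∏ e ∈ (S n).H, indicatorFn (E n e) x) ≤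
      1 / ((n : ℝ) + 2))
    {ε : ℝ} (hε : 0 < ε) : ∃ n, (S n).Removable (E n) ε n := by
  classical
  -- There are finitely many hypergraphs on `J`, so the ultrafilter selects one.
  obtain ⟨H, hH⟩ : ∃ H, ∀ᶠ n in hyperfilter ℕ, (S n).H = H := by
    rw [← Ultrafilter.eventually_exists_iff]
    exact Eventually.of_forall fun n => ⟨_, rfl⟩
  have hne : ∀ n, (S n).H.Nonempty := fun n =>
    edges_nonempty_of_expectation_lt_one ((hexp n).trans_lt
      (by rw [div_lt_one (by positivity)]; linarith [n.cast_nonneg (α := ℝ)]))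
  obtain ⟨n₀, hn₀⟩ := hH.exists
  set d : ℕ := (S n₀).d with hd
  have hcard : ∀ e ∈ H, e.card = d := fun e he => (S n₀).card_eq e (hn₀ ▸ he)
  let V : ℕ → J → Type v := fun n j => (S n).V j
  -- The condition on the hypergraph is needed because `E p.1 e.1` is known to depend only on `e`
  -- when `e` is an edge of that system.
  let A : {e // e ∈ H} → Set (Σ n, ∀ j, V n j) := fun e => {p | (S p.1).H = H ∧ p.2 ∈ E p.1 e.1}
  have hA : ∀ e, IsLocal e.1 (A e) := by
    intro e n x y hxy
    refine and_congr_right fun h => ?_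
    exact ((S n).measurableSet_sigmaAlg_iff e.1 _).mp (hE n e.1 (h ▸ e.2)) x y hxy
  have hAfreq : ∀ᶠ n in hyperfilter ℕ, freq (⋂ e, A e) n ≤ 1 / ((n : ℝ) + 2) := by
    filter_upwards [hH] with n hn
    refine le_of_eq_of_le ?_ (hexp n)
    rw [expectation_eq_avg, freq]
    congr 1
    ext x
    rw [hn]
    by_cases hx : ∀ e ∈ H, x ∈ E n e
    · have hxA : (⟨n, x⟩ : Σ n, ∀ j, V n j) ∈ ⋂ e, A e :=
        Set.mem_iInter.mpr fun e => ⟨hn, hx e.1 e.2⟩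
      rw [Set.indicator_of_mem hxA]
      exact (Finset.prod_eq_one fun e he => Set.indicator_of_mem (hx e he) _).symm
    · have hxA : (⟨n, x⟩ : Σ n, ∀ j, V n j) ∉ ⋂ e, A e := fun hcon =>
        hx fun e he => (Set.mem_iInter.mp hcon ⟨e, he⟩).2
      rw [Set.indicator_of_notMem hxA]
      push Not at hx
      obtain ⟨e, he, hxe⟩ := hx
      exact (Finset.prod_eq_zero he (Set.indicator_of_notMem hxe _)).symm
  have hAnull : prodLoeb V (⋂ e, lift (A e)) = 0 := by
    rw [← lift_iInter, ← measureReal_eq_zero_iff]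
    refine le_antisymm (le_of_tendsto_of_tendsto (tendsto_freq _) ?_ hAfreq) measureReal_nonneg
    refine Tendsto.mono_left ?_ Nat.hyperfilter_le_atTop
    exact tendsto_const_nhds.div_atTop
      (tendsto_atTop_add_const_right _ _ tendsto_natCast_atTop_atTop)
  let P : {e // e ∈ H} → Set (ProdUltra V) := fun e =>
    condPos (prodLoeb V) (sig V (low d e.1)) (lift (A e))
  have hPnull : prodLoeb V (⋂ e, P e) = 0 := by
    have := measure_iInter_condPos_inter_eq_zero (V := V) (e := fun e : {e // e ∈ H} => e.1)
      Subtype.val_injective (fun e => hcard e.1 e.2)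
      (fun e => (hA e).measurableSet_lift (Set.mem_singleton e.1))
      MeasurableSet.univ (by rwa [Set.inter_univ])
    rwa [Set.inter_univ] at this
  obtain ⟨F, hFgen, hFempty, hFsmall⟩ := exists_finGen_iInter_eq_empty d (fun e => e.1) P
    (fun e => measurableSet_condPos _) hPnull (half_pos hε)
  have hAF : ∀ e, ∀ᶠ n in hyperfilter ℕ, freq (A e \ F e) n < ε := by
    intro e
    refine (tendsto_freq (A e \ F e)).eventually_lt_const ?_
    rw [lift_diff]
    calc (prodLoeb V).real (lift (A e) \ lift (F e)) ≤
          (prodLoeb V).real ((lift (A e) \ P e) ∪ (P e \ lift (F e))) :=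
          measureReal_mono fun x hx => by
            by_cases hxP : x ∈ P e
            · exact Or.inr ⟨hxP, hx.2⟩
            · exact Or.inl ⟨hx.1, hxP⟩
      _ ≤ 0 + ε / 2 := (measureReal_union_le _ _).trans (add_le_add
          (measureReal_diff_condPos (sig_le _) (measurableSet_lift _)).le (hFsmall e))
      _ < ε := by linarith
  choose 𝒰 h𝒰fin h𝒰 hF𝒰 using hFgen
  let 𝒯 : Set (Set (Σ n, ∀ j, V n j)) := ⋃ e, 𝒰 e
  have h𝒯 : 𝒯.Finite := Set.finite_iUnion h𝒰fin
  -- The size of `𝒯` is a fixed finite number, so the complexity bound `n` eventually exceeds or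
  -- equals it.
  obtain ⟨n, hnH, hnF, hn𝒯⟩ := (hH.and ((eventually_all.mpr hAF).and
    (Nat.hyperfilter_le_atTop (eventually_ge_atTop 𝒯.ncard)))).exists
  let fib : Set (Σ n, ∀ j, V n j) → Set (S n).Total := fun T => {x | (⟨n, x⟩ : Σ n, ∀ j, V n j) ∈ T}
  have hfib : ∀ {e : Finset J} {T : Set (Σ n, ∀ j, V n j)}, IsLocal e T →
      MeasurableSet[(S n).sigmaAlg e] (fib T) := fun hT =>
    ((S n).measurableSet_sigmaAlg_iff _ _).mpr fun x y hxy => hT n x y hxy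
  have hdn : (S n).d = d := by
    obtain ⟨e, he⟩ := hne n
    rw [← (S n).card_eq e he, hcard e (hnH ▸ he)]
  let E' : Finset J → Set (S n).Total := fun e => if h : e ∈ H then fib (F ⟨e, h⟩) else ∅
  let B : Finset J → MeasurableSpace (S n).Total := fun e' =>
    MeasurableSpace.generateFrom (fib '' {T | T ∈ 𝒯 ∧ IsLocal e' T})
  have hE' : ∀ (e : Finset J) (m : MeasurableSpace (S n).Total) (he : e ∈ H),
      (∀ T ∈ 𝒰 ⟨e, he⟩, MeasurableSet[m] (fib T)) → MeasurableSet[m] (E' e) := by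
    intro e m he hm
    have := (h𝒰fin ⟨e, he⟩).to_subtype
    refine measurableSet_of_determined m (fun T : 𝒰 ⟨e, he⟩ => fib T.1) (fun T => hm T.1 T.2) ?_
    intro x y hxy
    simp only [E', dif_pos he]
    exact hF𝒰 ⟨e, he⟩ n x y fun T hT => hxy ⟨T, hT⟩
  refine ⟨n, E', B, fun e he => ?_, ?_, fun e he => ?_, fun e' he' => ⟨?_, ?_⟩, fun e he => ?_⟩
  · rw [hnH] at he
    refine hE' e _ he fun T hT => ?_
    obtain ⟨e', he', hT'⟩ := h𝒰 _ hT
    exact hfib (hT'.mono he'.1)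
  · refine Set.subset_empty_iff.mp fun x hx => ?_
    have : (⟨n, x⟩ : Σ n, ∀ j, V n j) ∈ ⋂ e, F e := by
      refine Set.mem_iInter.mpr fun e => ?_
      have := Set.mem_iInter₂.mp hx e.1 (hnH ▸ e.2)
      simp only [E', dif_pos e.2] at this
      exact this
    rw [hFempty] at this
    exact this
  · rw [hnH] at he
    refine le_of_eq_of_le ?_ (hnF ⟨e, he⟩).le
    rw [expectation_eq_avg, freq]
    congr 1
    ext x
    have hiff : x ∈ E n e \ E' e ↔ (⟨n, x⟩ : Σ n, ∀ j, V n j) ∈ A ⟨e, he⟩ \ F ⟨e, he⟩ := by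
      simp only [E', dif_pos he]
      exact ⟨fun h => ⟨⟨hnH, h.1⟩, h.2⟩, fun h => ⟨h.1.2, h.2⟩⟩
    by_cases hx : x ∈ E n e \ E' e
    · rw [indicatorFn, Set.indicator_of_mem hx, Set.indicator_of_mem (hiff.mp hx)]
    · rw [indicatorFn, Set.indicator_of_notMem hx, Set.indicator_of_notMem (mt hiff.mpr hx)]
  · refine MeasurableSpace.generateFrom_le ?_
    rintro _ ⟨T, hT, rfl⟩
    exact hfib hT.2
  · calc sigmaComplexity (B e') ≤ (fib '' {T | T ∈ 𝒯 ∧ IsLocal e' T}).encard :=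
          sigmaComplexity_generateFrom_le _
      _ ≤ 𝒯.encard := (Set.encard_image_le _ _).trans (Set.encard_le_encard fun T hT => hT.1)
      _ = (𝒯.ncard : ℕ∞) := h𝒯.cast_ncard_eq.symm
      _ ≤ n := Nat.cast_le.mpr hn𝒯
  · rw [hnH] at he
    refine hE' e _ he fun T hT => ?_
    obtain ⟨e', he', hT'⟩ := h𝒰 _ hT
    have hlt : e' ⊂ e := he'.1.ssubset_of_ne fun hcon => by
      have h1 := he'.2
      rw [hcon, hcard e he] at h1
      exact lt_irrefl _ h1
    exact le_iSup₂ (f := fun (e' : Finset J) (_ : e' ⊂ e) => B e') e' hlt _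
      (MeasurableSpace.measurableSet_generateFrom
        ⟨T, ⟨Set.mem_iUnion.mpr ⟨⟨e, he⟩, hT⟩, hT'⟩, rfl⟩)

theorem exists_removable_of_expectation_le (J : Type u) [Fintype J] [DecidableEq J] {ε : ℝ}
    (hε : 0 < ε) : ∃ (δ : ℝ) (N : ℕ), 0 < δ ∧
      ∀ (S : HypergraphSystem.{u, v} J) (E : Finset J → Set S.Total),
        (∀ e ∈ S.H, MeasurableSet[S.sigmaAlg e] (E e)) →
        S.expectation (fun x => ∏ e ∈ S.H, indicatorFn (E e) x) ≤ δ → S.Removable E ε N := by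
  by_contra! hcon
  choose S E hE hexp hrem using fun n : ℕ => hcon (1 / ((n : ℝ) + 2)) n (by positivity)
  obtain ⟨n, hn⟩ := exists_removable_of_sequence S E hE hexp hε
  exact hrem n hn

end HypergraphSystem

/-! ### From fixed ε to the functions of δ -/

theorem theorem1p5 (J : Type u) [Fintype J] [DecidableEq J] :
    ∃ (c : ℝ → ℝ) (C : ℝ → ℕ), Tendsto c (𝓝[>] 0) (𝓝 0) ∧
      ∀ (S : HypergraphSystem.{u, v} J) (E : Finset J → Set S.Total) (δ : ℝ),
        0 < δ → δ < 1 →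
        (∀ e ∈ S.H, MeasurableSet[S.sigmaAlg e] (E e)) →
        S.expectation (fun x => ∏ e ∈ S.H, indicatorFn (E e) x) ≤ δ →
        ∃ (E' : Finset J → Set S.Total) (B : Finset J → MeasurableSpace S.Total),
          (∀ e ∈ S.H, MeasurableSet[S.sigmaAlg e] (E' e)) ∧
          (⋂ e ∈ S.H, E' e) = ∅ ∧
          (∀ e ∈ S.H, S.expectation (indicatorFn (E e \ E' e)) ≤ c δ) ∧
          (∀ e' : Finset J, e'.card < S.d →
            B e' ≤ S.sigmaAlg e' ∧ sigmaComplexity (B e') ≤ (C δ : ℕ∞)) ∧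
          (∀ e ∈ S.H, MeasurableSet[⨆ (e' : Finset J) (_ : e' ⊂ e), B e'] (E' e)) := by
  classical
  choose D N hD hrem using fun k : ℕ =>
    HypergraphSystem.exists_removable_of_expectation_le.{u, v} J
      (ε := 1 / ((k : ℝ) + 1)) (by positivity)
  -- The best accuracy index whose threshold `D k` still admits δ. The cap makes the search finite
  -- and tends to infinity as δ → 0.
  let K : ℝ → ℕ := fun δ => Nat.findGreatest (fun k => δ ≤ D k) ⌊1 / δ⌋₊
  refine ⟨fun δ => 1 / ((K δ : ℝ) + 1), fun δ => N (K δ), ?_, ?_⟩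
  · have hK : Tendsto K (𝓝[>] 0) atTop := by
      refine tendsto_atTop.mpr fun k => ?_
      have h1 : ∀ᶠ δ : ℝ in 𝓝[>] 0, δ < D k :=
        (eventually_lt_nhds (hD k)).filter_mono nhdsWithin_le_nhds
      have h2 : ∀ᶠ δ : ℝ in 𝓝[>] 0, δ < 1 / ((k : ℝ) + 1) :=
        (eventually_lt_nhds (by positivity)).filter_mono nhdsWithin_le_nhds
      filter_upwards [h1, h2, self_mem_nhdsWithin] with δ h1 h2 h3
      refine Nat.le_findGreatest (Nat.le_floor ?_) h1.le
      have h3' : (0 : ℝ) < δ := h3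
      rw [lt_div_iff₀ (by positivity)] at h2
      rw [le_div_iff₀ h3']
      nlinarith
    exact tendsto_one_div_add_atTop_nhds_zero_nat.comp hK
  · intro S E δ hδ0 hδ1 hE hexp
    change S.Removable E (1 / ((K δ : ℝ) + 1)) (N (K δ))
    -- The value 0 may be the default of `Nat.findGreatest`, with no guarantee that δ ≤ `D 0`; the
    -- error bound is then 1, which is trivial.
    by_cases hK : K δ = 0
    · rw [hK, Nat.cast_zero, zero_add, div_one]
      exact HypergraphSystem.removable_one
        (HypergraphSystem.edges_nonempty_of_expectation_lt_one (hexp.trans_lt hδ1)) _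
    · exact hrem (K δ) S E hE (hexp.trans (Nat.findGreatest_of_ne_zero rfl hK))
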